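/- Let $n\ge 1$. Balls are open Euclidean balls $B=B(c,r)$ in $\mathbb{R}^n$ with $r>0$; $|E|$ is Lebesgue measure and $\chi_E$ the characteristic function of $E$. Let $\varphi$ be a function from the set of balls to $(0,\infty)$ that is doubling, $\varphi(2B)\le D\,\varphi(B)$ for all balls $B$ (where $2B=B(c,2r)$), and reverse doubling, $\varphi(B_1)/\varphi(B_2)\le K\,(|B_1|/|B_2|)^{\delta}$ for all balls $B_1\subset B_2$, with constants $D,K$ and $\delta>0$. Let $w$ be a weight, that is, a nonnegative locally integrable function on $\mathbb{R}^n$, and write $w(E)=\int_E w$. For $1\le p<\infty$ and measurable $f$ put $$\|f\|_{\mathcal{LM}^p(\varphi,w)}=\sup_{R>0}\Big(\frac1{\varphi(B(0,R))}\int_{B(0,R)}|f|^p w\Big)^{1/p},$$ $$\|f\|_{W\mathcal{LM}^p(\varphi,w)}=\sup_{R>0}\sup_{t>0}\frac{t\,w(\{x\in B(0,R):|f(x)|>t\})^{1/p}}{\varphi(B(0,R))^{1/p}},$$ let $\mathcal{LM}^p(\varphi,w)$ and $W\mathcal{LM}^p(\varphi,w)$ be the spaces of measurable functions for which these are finite,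 and let $\|g\|_{\mathcal{LM}^p(\varphi,w)'}=\sup\{\int_{\mathbb{R}^n}|fg| : \|f\|_{\mathcal{LM}^p(\varphi,w)}\le1\}$ be the norm of the Köthe dual. Put $$[w]_{A(\mathcal{LM}^p(\varphi))}=\sup_B\frac{\|\chi_B\|_{\mathcal{LM}^p(\varphi,w)}\,\|\chi_B\|_{\mathcal{LM}^p(\varphi,w)'}}{|B|}\in[0,\infty]$$ (supremum over all balls, $0\cdot\infty=0$), and write $w\in A(\mathcal{LM}^p(\varphi))$ if this is finite. Let $Mf(x)=\sup_{B\ni x}\frac1{|B|}\int_B|f|$ be the (uncentered) Hardy–Littlewood maximal operator. (a) Let $1<p<\infty$. Then $M$ is bounded on $\mathcal{LM}^p(\varphi,w)$ if and only if $w\in A(\mathcal{LM}^p(\varphi))$. (b) Let $1\le p<\infty$. Then $M$ is bounded from $\mathcal{LM}^p(\varphi,w)$ to $W\mathcal{LM}^p(\varphi,w)$ if and only if $w\in A(\mathcal{LM}^p(\varphi))$. Moreover, there are constants $c_1,c_2>0$ depending only on $n,p,D,K,\delta$ such that $$c_1\,[w]_{A(\mathcal{LM}^p(\varphi))}\le \|M\|_{\mathcal{LM}^p(\varphi,w)\to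 W\mathcal{LM}^p(\varphi,w)}\le c_2\,[w]_{A(\mathcal{LM}^p(\varphi))}.$$ -/

import Mathlib

open MeasureTheory Metric
open scoped ENNReal NNReal

noncomputable section

/-- The Euclidean space of dimension `n`, with the Euclidean norm and Lebesgue measure. -/
abbrev RSpace (n : ℕ) : Type := EuclideanSpace ℝ (Fin n)

/-- A weight: a nonnegative locally integrable function. -/
def IsWeight {n : ℕ} (w : RSpace n → ℝ) : Prop :=
  (∀ x, 0 ≤ w x) ∧ LocallyIntegrable w volume

/-- A function `φ` on balls is encoded as a function of center and radius; only radii `r > 0` are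
ever used. It takes values in `(0, ∞)`. -/
def PositiveOnBalls {n : ℕ} (φ : RSpace n → ℝ → ℝ) : Prop :=
  ∀ c r, 0 < r → 0 < φ c r

/-- Doubling: `φ(2B) ≤ D φ(B)` for all balls `B`. -/
def DoublingOnBalls {n : ℕ} (φ : RSpace n → ℝ → ℝ) (D : ℝ) : Prop :=
  ∀ c r, 0 < r → φ c (2 * r) ≤ D * φ c r

/-- Reverse doubling: `φ(B₁) / φ(B₂) ≤ K (|B₁| / |B₂|) ^ δ` for all balls `B₁ ⊆ B₂`. -/
def ReverseDoublingOnBalls {n : ℕ} (φ : RSpace n → ℝ → ℝ) (K δ : ℝ) : Prop :=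
  ∀ c₁ r₁ c₂ r₂, 0 < r₁ → 0 < r₂ → ball c₁ r₁ ⊆ ball c₂ r₂ →
    φ c₁ r₁ / φ c₂ r₂ ≤ K * (volume.real (ball c₁ r₁) / volume.real (ball c₂ r₂)) ^ δ

/-- The absolute value of a function, as a function with values in `[0, ∞]`. -/
def absFun {n : ℕ} (f : RSpace n → ℝ) : RSpace n → ℝ≥0∞ := fun x => ‖f x‖ₑ

/-- The local Morrey norm of a function with absolute value `g`:
the supremum over `R > 0` of `(φ(B(0,R))⁻¹ ∫_{B(0,R)} g ^ p w) ^ (1 / p)`. -/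
def localMorreyNorm {n : ℕ} (φ : RSpace n → ℝ → ℝ) (w : RSpace n → ℝ) (p : ℝ)
    (g : RSpace n → ℝ≥0∞) : ℝ≥0∞ :=
  ⨆ (R : ℝ) (_ : 0 < R),
    ((∫⁻ x in ball 0 R, g x ^ p * ENNReal.ofReal (w x)) / ENNReal.ofReal (φ 0 R)) ^ (1 / p)

/-- The weak local Morrey quasinorm of a function with absolute value `g`: the supremum over
`R > 0` and `t > 0` of `t w({x ∈ B(0,R) : g x > t}) ^ (1 / p) / φ(B(0,R)) ^ (1 / p)`. -/
def weakLocalMorreyNorm {n : ℕ} (φ : RSpace n → ℝ → ℝ) (w : RSpace n → ℝ) (p : ℝ)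
    (g : RSpace n → ℝ≥0∞) : ℝ≥0∞ :=
  ⨆ (R : ℝ) (_ : 0 < R) (t : ℝ) (_ : 0 < t),
    ENNReal.ofReal t *
      (∫⁻ x in {x | x ∈ ball 0 R ∧ ENNReal.ofReal t < g x}, ENNReal.ofReal (w x)) ^ (1 / p) /
      ENNReal.ofReal (φ 0 R) ^ (1 / p)

/-- The norm in the Köthe dual of the space of (Lebesgue) measurable functions `f` with
`N |f| < ∞`, of a function with absolute value `g`: the supremum of `∫ |f| g` over `N |f| ≤ 1`. -/
def kotheDualNorm {n : ℕ} (N : (RSpace n → ℝ≥0∞) → ℝ≥0∞) (g : RSpace n → ℝ≥0∞) : ℝ≥0∞ :=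
  ⨆ (f : RSpace n → ℝ) (_ : AEMeasurable f volume) (_ : N (absFun f) ≤ 1),
    ∫⁻ x, absFun f x * g x

/-- The characteristic function of a set. -/
def charFn {n : ℕ} (s : Set (RSpace n)) : RSpace n → ℝ≥0∞ := s.indicator (fun _ => 1)

/-- The constant of `w` for the Muckenhoupt-type condition: the supremum over all balls `B` of
`‖χ_B‖ ‖χ_B‖' / |B|`, with the local Morrey norm and its Köthe dual norm. -/
def localMorreyAConst {n : ℕ} (φ : RSpace n → ℝ → ℝ) (w : RSpace n → ℝ) (p : ℝ) : ℝ≥0∞ :=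
  ⨆ (c : RSpace n) (r : ℝ) (_ : 0 < r),
    localMorreyNorm φ w p (charFn (ball c r)) *
      kotheDualNorm (localMorreyNorm φ w p) (charFn (ball c r)) / volume (ball c r)

/-- Membership of `w` in the Muckenhoupt-type class of the local Morrey space. -/
def MemLocalMorreyA {n : ℕ} (φ : RSpace n → ℝ → ℝ) (w : RSpace n → ℝ) (p : ℝ) : Prop :=
  localMorreyAConst φ w p < ∞

/-- The (uncentered) Hardy-Littlewood maximal operator: the supremum of the averages of `|f|`
over all balls containing `x`. -/
def hlMaximal {n : ℕ} (f : RSpace n → ℝ) (x : RSpace n) : ℝ≥0∞ :=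
  ⨆ (c : RSpace n) (r : ℝ) (_ : 0 < r) (_ : x ∈ ball c r),
    (∫⁻ y in ball c r, absFun f y) / volume (ball c r)

/-- `C` is a bound for `T` from the space with norm `N₁` to the space with norm `N₂`. -/
def IsOperatorBound {n : ℕ} (T : (RSpace n → ℝ) → RSpace n → ℝ≥0∞)
    (N₁ N₂ : (RSpace n → ℝ≥0∞) → ℝ≥0∞) (C : ℝ≥0∞) : Prop :=
  ∀ f : RSpace n → ℝ, AEMeasurable f volume → N₁ (absFun f) < ∞ → N₂ (T f) ≤ C * N₁ (absFun f)

/-- `T` is bounded from the space with norm `N₁` to the space with norm `N₂`. -/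
def IsBoundedOperator {n : ℕ} (T : (RSpace n → ℝ) → RSpace n → ℝ≥0∞)
    (N₁ N₂ : (RSpace n → ℝ≥0∞) → ℝ≥0∞) : Prop :=
  ∃ C : ℝ≥0, IsOperatorBound T N₁ N₂ C

/-- The operator norm: the infimum of all bounds (`∞` if `T` is not bounded). -/
def operatorNorm {n : ℕ} (T : (RSpace n → ℝ) → RSpace n → ℝ≥0∞)
    (N₁ N₂ : (RSpace n → ℝ≥0∞) → ℝ≥0∞) : ℝ≥0∞ :=
  sInf {C : ℝ≥0∞ | IsOperatorBound T N₁ N₂ C}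

end

/-! Necessity is a test on one ball B. On B the function Mf is at least the average of |f|, so a
weak bound C controls that average times ‖χ_B‖. Taking the supremum over the unit ball gives [w] ≤
C, with constant exactly 1 (`localMorreyAConst_le_of_isOperatorBound`). A strong bound implies a
weak one by Chebyshev.

For sufficiency, cut B(0,R) into the shells ρ/2 ≤ |x| < ρ, ρ = R/2^i. Reverse doubling makes the
values φ(B(0,ρ)) summable to a multiple of φ(B(0,R)), so it suffices to estimate each shell by
φ(B(0,ρ)) (`measure_ball_le_of_shell`). For x in a shell, the balls through x are of two kinds
(`hlMaximal_le_max_of_mem_shell`).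

Large balls, of radius s > ρ/32, lie in B(0,34s), which also contains B(0,ρ). The hypothesis on that
single ball bounds the average (`largeBallMaximal_rpow_mul_le`).

Small balls are replaced by centered ones staying at distance comparable to ρ from the origin. For
functions supported there only radii R ≥ ρ/4 contribute, and φ(B(0,ρ)) is bounded by a multiple of
φ(B(0,R)). The Morrey norm is then at most a multiple of a normalized L^p(w) norm, and the
hypothesis becomes the classical A_p condition on these balls
(`setLIntegral_rpow_mul_weightMeasure_le`). The Besicovitch theorem turns it directly into the weak
type bound, linearly in [w].

For the strong type, the dual weight σ = w^(-1/(p-1)) is inserted as a test function, and the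
centered maximal function is dominated by M_w(M_σ(g/σ)^(p-1) w⁻¹)^(1/(p-1))
(`centeredMaximal_rpow_le`). Both centered operators are bounded on L^q of their own measure for q >
1, by Besicovitch and without doubling, so no self-improvement of A_p is needed. -/

/-! ### Besicovitch covering and centered maximal functions -/

/-- A Besicovitch-type comparison of measures: if every point of `A` is the center of a closed
ball of bounded radius on which `μ ≤ ν`, then `μ A` is controlled by the total mass of `ν`. -/
theorem exists_besicovitch_const (n : ℕ) : ∃ N : ℕ, ∀ (μ ν : Measure (RSpace n))
    (A : Set (RSpace n)) (ρ : ℝ),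
    (∀ x ∈ A, ∃ r, 0 < r ∧ r ≤ ρ ∧ μ (closedBall x r) ≤ ν (closedBall x r)) →
      μ A ≤ N * ν Set.univ := by
  obtain ⟨N, τ, hτ, hN⟩ := HasBesicovitchCovering.no_satelliteConfig (α := RSpace n)
  refine ⟨N, fun μ ν A ρ h => ?_⟩
  choose! r hr0 hrρ hr using h
  let q : Besicovitch.BallPackage A (RSpace n) :=
    { c := fun x => x, r := fun x => r x, rpos := fun x => hr0 x x.2, r_bound := ρ,
      r_le := fun x => hrρ x x.2 }
  obtain ⟨s, hs, hcov⟩ := Besicovitch.exist_disjoint_covering_families hτ hN q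
  have hcount : ∀ i, (s i).Countable := fun i => by
    refine (hs i).countable_of_nonempty_interior fun j _ => ?_
    exact ⟨q.c j, ball_subset_interior_closedBall (mem_ball_self (q.rpos j))⟩
  -- Besicovitch supplies N families, each of pairwise disjoint balls. Inside one family ν is
  -- additive, so the family costs at most the total mass. Only the balls need to be measurable, not
  -- A.
  calc μ A ≤ μ (⋃ i : Fin N, ⋃ j ∈ s i, closedBall (q.c j) (q.r j)) := by
        refine measure_mono fun x hx => ?_
        have := hcov ⟨⟨x, hx⟩, rfl⟩
        simp only [Set.mem_iUnion] at this ⊢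
        obtain ⟨i, j, hj, hm⟩ := this
        exact ⟨i, j, hj, ball_subset_closedBall hm⟩
    _ ≤ ∑ i : Fin N, μ (⋃ j ∈ s i, closedBall (q.c j) (q.r j)) := measure_iUnion_fintype_le _ _
    _ ≤ ∑ _i : Fin N, ν Set.univ := by
        refine Finset.sum_le_sum fun i _ => ?_
        have := (hcount i).to_subtype
        calc μ (⋃ j ∈ s i, closedBall (q.c j) (q.r j))
            ≤ ∑' j : s i, μ (closedBall (q.c j) (q.r j)) := measure_biUnion_le μ (hcount i) _
          _ ≤ ∑' j : s i, ν (closedBall (q.c j) (q.r j)) :=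
              ENNReal.tsum_le_tsum fun j => hr _ j.1.2
          _ = ν (⋃ j ∈ s i, closedBall (q.c j) (q.r j)) :=
              (measure_biUnion (hcount i) (hs i) fun j _ => isClosed_closedBall.measurableSet).symm
          _ ≤ ν Set.univ := measure_mono (Set.subset_univ _)
    _ = N * ν Set.univ := by simp

/-- The centered maximal function of `g` with respect to a measure `μ`, along the radii
`a / 2 ^ m`. -/
noncomputable def centeredMaximal {n : ℕ} (μ : Measure (RSpace n)) (a : ℝ) (g : RSpace n → ℝ≥0∞)
    (x : RSpace n) : ℝ≥0∞ :=
  ⨆ m : ℕ, (∫⁻ y in closedBall x (a / 2 ^ m), g y ∂μ) / μ (closedBall x (a / 2 ^ m))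

theorem measurable_setLIntegral_closedBall {n : ℕ} (μ : Measure (RSpace n)) [SFinite μ] (r : ℝ)
    {g : RSpace n → ℝ≥0∞} (hg : Measurable g) :
    Measurable fun x => ∫⁻ y in closedBall x r, g y ∂μ := by
  have h : Measurable fun z : RSpace n × RSpace n =>
      {z : RSpace n × RSpace n | dist z.2 z.1 ≤ r}.indicator (fun z => g z.2) z := by
    refine (hg.comp measurable_snd).indicator ?_
    exact measurableSet_le (measurable_snd.dist measurable_fst) measurable_const
  have e : (fun x => ∫⁻ y in closedBall x r, g y ∂μ) = fun x => ∫⁻ y,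
      {z : RSpace n × RSpace n | dist z.2 z.1 ≤ r}.indicator (fun z => g z.2) (x, y) ∂μ := by
    ext x
    exact (lintegral_indicator (isClosed_closedBall (x := x) (ε := r)).measurableSet _).symm
  rw [e]
  exact h.lintegral_prod_right' (ν := μ)

/-- Restricting to countably many radii makes this a countable supremum of measurable functions. -/
theorem measurable_centeredMaximal {n : ℕ} (μ : Measure (RSpace n)) [SFinite μ] (a : ℝ)
    {g : RSpace n → ℝ≥0∞} (hg : AEMeasurable g μ) : Measurable (centeredMaximal μ a g) := by
  have : centeredMaximal μ a g = centeredMaximal μ a (hg.mk g) := by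
    ext x
    refine iSup_congr fun m => ?_
    rw [lintegral_congr_ae (ae_restrict_of_ae hg.ae_eq_mk)]
  rw [this]
  refine Measurable.iSup fun m => ?_
  refine (measurable_setLIntegral_closedBall μ _ hg.measurable_mk).div ?_
  simpa using measurable_setLIntegral_closedBall μ (a / 2 ^ m) (g := fun _ => 1) measurable_const

/-- The layer-cake formula at a single value: the integrand is t^(s-1) on 0 < t < x. The value x = ∞
is included and is reached by exhausting with finite levels. -/
theorem lintegral_Ioi_indicator_rpow {s : ℝ} (hs : 0 < s) (x : ℝ≥0∞) :
    ∫⁻ t in Set.Ioi (0 : ℝ), {t : ℝ | ENNReal.ofReal t < x}.indicator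
      (fun t => ENNReal.ofReal (t ^ (s - 1))) t = x ^ s / ENNReal.ofReal s := by
  have key : ∀ y : ℝ, 0 ≤ y → ∫⁻ t in Set.Ioi (0 : ℝ), {t : ℝ | ENNReal.ofReal t < ENNReal.ofReal y}.indicator
      (fun t => ENNReal.ofReal (t ^ (s - 1))) t = ENNReal.ofReal y ^ s / ENNReal.ofReal s := by
    intro y hy
    have hset : {t : ℝ | ENNReal.ofReal t < ENNReal.ofReal y} ∩ Set.Ioi 0 = Set.Ioo 0 y := by
      ext t
      simp only [Set.mem_inter_iff, Set.mem_ofPred_eq, Set.mem_Ioi, Set.mem_Ioo]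
      constructor
      · rintro ⟨h1, h2⟩
        exact ⟨h2, ((ENNReal.ofReal_lt_ofReal_iff_of_nonneg h2.le).1 h1)⟩
      · rintro ⟨h1, h2⟩
        exact ⟨(ENNReal.ofReal_lt_ofReal_iff_of_nonneg h1.le).2 h2, h1⟩
    rw [lintegral_indicator (measurableSet_lt ENNReal.measurable_ofReal measurable_const),
      Measure.restrict_restrict (measurableSet_lt ENNReal.measurable_ofReal measurable_const), hset,
      restrict_Ioo_eq_restrict_Ioc, ← ofReal_integral_eq_lintegral_ofReal,
      ← intervalIntegral.integral_of_le hy, integral_rpow (Or.inl (by linarith)),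
      ENNReal.ofReal_rpow_of_nonneg hy hs.le, ← ENNReal.ofReal_div_of_pos hs]
    · simp [Real.zero_rpow hs.ne']
    · exact (intervalIntegral.intervalIntegrable_rpow' (by linarith)).1
    · filter_upwards [ae_restrict_mem measurableSet_Ioc] with t ht
      exact Real.rpow_nonneg ht.1.le _
  rcases eq_or_ne x ⊤ with rfl | hx
  · rw [ENNReal.top_rpow_of_pos hs, ENNReal.top_div_of_ne_top ENNReal.ofReal_ne_top]
    refine ENNReal.eq_top_of_forall_nnreal_le fun y => ?_
    have h2 : (y : ℝ≥0∞) * ENNReal.ofReal s = ENNReal.ofReal ((y * s) ^ (1 / s)) ^ s := by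
      rw [ENNReal.ofReal_rpow_of_nonneg (by positivity) hs.le, ← Real.rpow_mul (by positivity),
        one_div_mul_cancel hs.ne', Real.rpow_one, ENNReal.ofReal_mul (NNReal.coe_nonneg y), ENNReal.ofReal_coe_nnreal]
    calc (y : ℝ≥0∞) = ENNReal.ofReal ((y * s) ^ (1 / s)) ^ s / ENNReal.ofReal s := by
          rw [← h2, ENNReal.mul_div_cancel_right (by simpa using hs) ENNReal.ofReal_ne_top]
      _ = _ := (key _ (by positivity)).symm
      _ ≤ _ := by
          refine lintegral_mono fun t => Set.indicator_le_indicator_of_subset ?_ (fun _ => zero_le) t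
          intro t _
          exact ENNReal.ofReal_lt_top
  · rw [← ENNReal.ofReal_toReal hx]
    exact key _ ENNReal.toReal_nonneg

/-- The truncated weak type estimate for the centered maximal function. -/
theorem measure_lt_centeredMaximal_le {n N : ℕ}
    (hN : ∀ (μ ν : Measure (RSpace n)) (A : Set (RSpace n)) (ρ : ℝ),
      (∀ x ∈ A, ∃ r, 0 < r ∧ r ≤ ρ ∧ μ (closedBall x r) ≤ ν (closedBall x r)) →
        μ A ≤ N * ν Set.univ)
    (μ : Measure (RSpace n)) [SFinite μ] {a : ℝ} (ha : 0 < a) {g : RSpace n → ℝ≥0∞}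
    (hg : Measurable g) {t : ℝ} (ht : 0 < t) :
    μ {x | ENNReal.ofReal t < centeredMaximal μ a g x} ≤
      N * ((2 / ENNReal.ofReal t) *
        ∫⁻ x, {x | ENNReal.ofReal t < 2 * g x}.indicator g x ∂μ) := by
  -- Cut g at height t/2. The part below contributes at most t/2 to any average, so where the
  -- average exceeds t the part above carries mass at least (t/2) μ(B). This makes μ(B) at most the
  -- mass of the density `h`.
  set G : Set (RSpace n) := {x | ENNReal.ofReal t < 2 * g x}
  have hG : MeasurableSet G := measurableSet_lt measurable_const (hg.const_mul 2)
  set h := fun x => (2 / ENNReal.ofReal t) * G.indicator g x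
  have ht0 : ENNReal.ofReal t ≠ 0 := by simpa using ht
  have htop : (2 / ENNReal.ofReal t) ≠ ⊤ := ENNReal.div_ne_top (by simp) ht0
  have hGm : Measurable (G.indicator g) := hg.indicator hG
  refine (hN μ (μ.withDensity h) _ a fun x hx => ?_).trans (le_of_eq ?_)
  · obtain ⟨m, hm⟩ := lt_iSup_iff.1 (show ENNReal.ofReal t < centeredMaximal μ a g x from hx)
    refine ⟨a / 2 ^ m, by positivity, div_le_self ha.le (one_le_pow₀ (by norm_num)), ?_⟩
    set B := closedBall x (a / 2 ^ m)
    have hB : MeasurableSet B := isClosed_closedBall.measurableSet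
    rw [withDensity_apply _ hB, lintegral_const_mul _ hGm]
    -- If μ(B) were infinite the quotient would be 0 and could not exceed t.
    have hBtop : μ B ≠ ⊤ := fun h => by simp [h] at hm
    have h1 : ENNReal.ofReal t * μ B ≤ ∫⁻ y in B, g y ∂μ := ENNReal.mul_le_of_le_div hm.le
    have h2 : ∫⁻ y in B, g y ∂μ ≤ (∫⁻ y in B, G.indicator g y ∂μ) + ENNReal.ofReal t / 2 * μ B := by
      rw [← setLIntegral_const, ← lintegral_add_left hGm]
      refine lintegral_mono fun y => ?_
      by_cases hy : y ∈ G
      · simp [hy]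
      · rw [Set.indicator_of_notMem hy, zero_add, ENNReal.le_div_iff_mul_le (by simp) (by simp), mul_comm]
        exact not_lt.1 hy
    have h3 : ENNReal.ofReal t / 2 * μ B ≤ ∫⁻ y in B, G.indicator g y ∂μ := by
      have h4 : ENNReal.ofReal t / 2 * μ B ≠ ⊤ :=
        ENNReal.mul_ne_top (ENNReal.div_ne_top ENNReal.ofReal_ne_top (by simp)) hBtop
      refine (ENNReal.add_le_add_iff_right h4).1 ?_
      rw [← add_mul, ENNReal.add_halves]
      exact h1.trans h2
    calc μ B = 2 / ENNReal.ofReal t * (ENNReal.ofReal t / 2 * μ B) := by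
          rw [← mul_assoc, ← ENNReal.inv_div (by simp) (by simp), ENNReal.inv_mul_cancel, one_mul]
          · exact (ENNReal.div_pos ht0 (by simp)).ne'
          · exact ENNReal.div_ne_top ENNReal.ofReal_ne_top (by simp)
      _ ≤ _ := by gcongr
  · rw [withDensity_apply _ MeasurableSet.univ, Measure.restrict_univ, lintegral_const_mul _ hGm]

/-- Boundedness of the centered maximal function of a measure on `L^q`, `q > 1`. -/
theorem exists_lintegral_centeredMaximal_rpow_le (n : ℕ) {q : ℝ} (hq : 1 < q) : ∃ C : ℝ≥0,
    ∀ (μ : Measure (RSpace n)) [SFinite μ] (a : ℝ) (_ : 0 < a) (g : RSpace n → ℝ≥0∞)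
      (_ : AEMeasurable g μ),
      ∫⁻ x, centeredMaximal μ a g x ^ q ∂μ ≤ C * ∫⁻ x, g x ^ q ∂μ := by
  obtain ⟨N, hN⟩ := exists_besicovitch_const n
  have hq0 : 0 < q := by linarith
  have hq1 : 0 < q - 1 := by linarith
  -- Marcinkiewicz interpolation: q comes from the layer-cake formula, 2N from the truncated weak
  -- type estimate, and the last factor from integrating t^(q-2) over 0 < t < 2g.
  set c : ℝ≥0∞ := ENNReal.ofReal q * (N * 2) * (2 ^ (q - 1) / ENNReal.ofReal (q - 1)) with hc
  have hctop : c ≠ ⊤ := by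
    refine ENNReal.mul_ne_top (ENNReal.mul_ne_top ENNReal.ofReal_ne_top (by finiteness)) ?_
    exact ENNReal.div_ne_top (by finiteness) (by simpa using hq)
  refine ⟨c.toNNReal, fun μ _ a ha g hg' => ?_⟩
  rw [ENNReal.coe_toNNReal hctop]
  wlog hg : Measurable g generalizing g
  · have := this (hg'.mk g) hg'.measurable_mk.aemeasurable hg'.measurable_mk
    have e : centeredMaximal μ a g = centeredMaximal μ a (hg'.mk g) := by
      ext x
      refine iSup_congr fun m => ?_
      rw [lintegral_congr_ae (ae_restrict_of_ae hg'.ae_eq_mk)]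
    rw [e]
    refine this.trans (le_of_eq ?_)
    congr 1
    refine lintegral_congr_ae ?_
    filter_upwards [hg'.ae_eq_mk] with x hx
    rw [hx]
  set F := centeredMaximal μ a g
  have hF : Measurable F := measurable_centeredMaximal μ a hg'
  have hpow : ∀ s : ℝ, Measurable fun t : ℝ => ENNReal.ofReal (t ^ s) := fun s =>
    ENNReal.measurable_ofReal.comp (measurable_id.pow_const s)
  have hjoint : ∀ (H : RSpace n → ℝ≥0∞) (s : ℝ), Measurable H →
      Measurable fun z : RSpace n × ℝ => {t : ℝ | ENNReal.ofReal t < H z.1}.indicator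
        (fun t => ENNReal.ofReal (t ^ s)) z.2 := by
    intro H s hH
    have : Measurable fun z : RSpace n × ℝ => {z : RSpace n × ℝ | ENNReal.ofReal z.2 < H z.1}.indicator
        (fun z => ENNReal.ofReal (z.2 ^ s)) z := by
      refine ((hpow s).comp measurable_snd).indicator ?_
      exact measurableSet_lt (ENNReal.measurable_ofReal.comp measurable_snd) (hH.comp measurable_fst)
    exact this
  have hpt : ∀ {s : ℝ} (_ : 0 < s) (y : ℝ≥0∞), y ^ s = ENNReal.ofReal s *
      ∫⁻ t in Set.Ioi (0 : ℝ), {t : ℝ | ENNReal.ofReal t < y}.indicator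
        (fun t => ENNReal.ofReal (t ^ (s - 1))) t := by
    intro s hs y
    rw [lintegral_Ioi_indicator_rpow hs, ENNReal.mul_div_cancel (by simpa using hs) ENNReal.ofReal_ne_top]
  calc ∫⁻ x, F x ^ q ∂μ
      = ENNReal.ofReal q * ∫⁻ t in Set.Ioi (0 : ℝ), ∫⁻ x, {t : ℝ | ENNReal.ofReal t < F x}.indicator
        (fun t => ENNReal.ofReal (t ^ (q - 1))) t ∂μ := by
        simp_rw [hpt hq0]
        rw [lintegral_const_mul _ (hjoint F _ hF).lintegral_prod_right', lintegral_lintegral_swap]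
        exact (hjoint F _ hF).aemeasurable
    _ ≤ ENNReal.ofReal q * ∫⁻ t in Set.Ioi (0 : ℝ), (N * 2) *
        ∫⁻ x, g x * {t : ℝ | ENNReal.ofReal t < 2 * g x}.indicator
          (fun t => ENNReal.ofReal (t ^ (q - 1 - 1))) t ∂μ := by
        gcongr ENNReal.ofReal q * ?_
        refine setLIntegral_mono' measurableSet_Ioi fun t ht => ?_
        have ht' : (0 : ℝ) < t := ht
        have e1 : ∀ (H : RSpace n → ℝ≥0∞) (s : ℝ) x, {t : ℝ | ENNReal.ofReal t < H x}.indicator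
            (fun t => ENNReal.ofReal (t ^ s)) t =
            ENNReal.ofReal (t ^ s) * {x | ENNReal.ofReal t < H x}.indicator 1 x := by
          intro H s x
          by_cases h : ENNReal.ofReal t < H x <;> simp [h]
        have e2 : ENNReal.ofReal (t ^ (q - 1)) = ENNReal.ofReal t * ENNReal.ofReal (t ^ (q - 1 - 1)) := by
          rw [← ENNReal.ofReal_mul ht'.le, Real.rpow_sub_one ht'.ne' (q - 1)]
          congr 1
          field_simp
        have m1 : MeasurableSet {x | ENNReal.ofReal t < F x} := measurableSet_lt measurable_const hF
        have m2 : MeasurableSet {x | ENNReal.ofReal t < 2 * g x} :=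
          measurableSet_lt measurable_const (hg.const_mul 2)
        have e3 : ∀ x, g x * {t : ℝ | ENNReal.ofReal t < 2 * g x}.indicator
            (fun t => ENNReal.ofReal (t ^ (q - 1 - 1))) t =
            ENNReal.ofReal (t ^ (q - 1 - 1)) * {x | ENNReal.ofReal t < 2 * g x}.indicator g x := by
          intro x
          rw [e1 (fun x => 2 * g x)]
          simp only [Set.indicator, Set.mem_ofPred_eq, Pi.one_apply]
          split_ifs <;> simp [mul_comm]
        simp_rw [e1 F, e3]
        rw [lintegral_const_mul _ (measurable_one.indicator m1), lintegral_indicator_one m1,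
          lintegral_const_mul _ (hg.indicator m2), e2]
        have ht0 : ENNReal.ofReal t ≠ 0 := by simpa using ht'
        calc _ ≤ ENNReal.ofReal t * ENNReal.ofReal (t ^ (q - 1 - 1)) * (N * ((2 / ENNReal.ofReal t) *
                ∫⁻ x, {x | ENNReal.ofReal t < 2 * g x}.indicator g x ∂μ)) := by
              gcongr
              exact measure_lt_centeredMaximal_le hN μ ha hg ht'
          _ = (ENNReal.ofReal t * (2 / ENNReal.ofReal t)) * (N * (ENNReal.ofReal (t ^ (q - 1 - 1)) *
                ∫⁻ x, {x | ENNReal.ofReal t < 2 * g x}.indicator g x ∂μ)) := by ring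
          _ = _ := by rw [ENNReal.mul_div_cancel ht0 ENNReal.ofReal_ne_top]; ring
    _ = ENNReal.ofReal q * (N * 2) * ∫⁻ x, g x * (∫⁻ t in Set.Ioi (0 : ℝ),
        {t : ℝ | ENNReal.ofReal t < 2 * g x}.indicator
          (fun t => ENNReal.ofReal (t ^ (q - 1 - 1))) t) ∂μ := by
        rw [lintegral_const_mul' _ _ (by finiteness), ← mul_assoc]
        congr 1
        rw [lintegral_lintegral_swap]
        · refine lintegral_congr fun x => ?_
          rw [lintegral_const_mul]
          exact (hjoint (fun x => 2 * g x) _ (hg.const_mul 2)).comp measurable_prodMk_left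
        · exact (((hg.comp measurable_snd).mul
            ((hjoint (fun x => 2 * g x) (q - 1 - 1) (hg.const_mul 2)).comp measurable_swap))).aemeasurable
    _ = ENNReal.ofReal q * (N * 2) * ∫⁻ x, (2 ^ (q - 1) / ENNReal.ofReal (q - 1)) * g x ^ q ∂μ := by
        congr 1
        refine lintegral_congr fun x => ?_
        rw [lintegral_Ioi_indicator_rpow hq1, ENNReal.mul_rpow_of_nonneg _ _ hq1.le]
        have : g x ^ q = g x * g x ^ (q - 1) := by
          conv_lhs => rw [show q = 1 + (q - 1) by ring, ENNReal.rpow_add_of_nonneg _ _ zero_le_one hq1.le, ENNReal.rpow_one]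
        rw [this, div_eq_mul_inv, div_eq_mul_inv]
        ring
    _ = c * ∫⁻ x, g x ^ q ∂μ := by
        rw [lintegral_const_mul _ (hg.pow_const q), hc, ← mul_assoc]

/-! ### The weighted measure, the growth of φ and volumes of balls -/

/-- The measure `w dx`. -/
noncomputable def weightMeasure {n : ℕ} (w : RSpace n → ℝ) : Measure (RSpace n) :=
  volume.withDensity fun x => ENNReal.ofReal (w x)

theorem weightMeasure_apply {n : ℕ} (w : RSpace n → ℝ) (s : Set (RSpace n)) :
    weightMeasure w s = ∫⁻ x in s, ENNReal.ofReal (w x) :=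
  withDensity_apply' _ _

theorem IsWeight.aemeasurable_ofReal {n : ℕ} {w : RSpace n → ℝ} (hw : IsWeight w) :
    AEMeasurable fun x => ENNReal.ofReal (w x) :=
  hw.2.aestronglyMeasurable.aemeasurable.ennreal_ofReal

theorem IsWeight.weightMeasure_ball_ne_top {n : ℕ} {w : RSpace n → ℝ} (hw : IsWeight w)
    (c : RSpace n) (r : ℝ) : weightMeasure w (ball c r) ≠ ⊤ := by
  rw [weightMeasure_apply]
  have h := (hw.2.integrableOn_isCompact (isCompact_closedBall c r)).mono_set
    (ball_subset_closedBall (x := c) (ε := r))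
  have h2 := h.2
  rw [hasFiniteIntegral_iff_ofReal (Filter.Eventually.of_forall hw.1)] at h2
  exact h2.ne

/-- The properties of the function `R ↦ φ(B(0, R))` used in the sequel. -/
structure CenteredGrowth {n : ℕ} (φ : RSpace n → ℝ → ℝ) (D K θ : ℝ) : Prop where
  one_le_D : 1 ≤ D
  one_le_K : 1 ≤ K
  pos : ∀ R, 0 < R → 0 < φ 0 R
  doubling : ∀ R, 0 < R → φ 0 (2 * R) ≤ D * φ 0 R
  reverse : ∀ r R, 0 < r → r ≤ R → φ 0 r ≤ K * (r / R) ^ θ * φ 0 R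

theorem CenteredGrowth.le_of_le {n : ℕ} {φ : RSpace n → ℝ → ℝ} {D K θ : ℝ}
    (h : CenteredGrowth φ D K θ) (hθ : 0 ≤ θ) {r R : ℝ} (hr : 0 < r) (hrR : r ≤ R) :
    φ 0 r ≤ K * φ 0 R := by
  have hK := h.one_le_K
  have hR := h.pos R (hr.trans_le hrR)
  refine (h.reverse r R hr hrR).trans ?_
  have : (r / R) ^ θ ≤ 1 := Real.rpow_le_one (by have := hr.trans_le hrR; positivity)
    ((div_le_one (hr.trans_le hrR)).2 hrR) hθ
  gcongr
  exact mul_le_of_le_one_right (by linarith) this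

/-- Two doublings pass from ρ/4 to ρ, and quasi-monotonicity covers the rest. The radii R ≥ ρ/4 are
those for which B(0,R) can meet a set lying outside B(0,ρ/4). -/
theorem CenteredGrowth.le_of_quarter_le {n : ℕ} {φ : RSpace n → ℝ → ℝ} {D K θ : ℝ}
    (h : CenteredGrowth φ D K θ) (hθ : 0 ≤ θ) {ρ R : ℝ} (hρ : 0 < ρ) (hR : ρ / 4 ≤ R) :
    φ 0 ρ ≤ D ^ 2 * K * φ 0 R := by
  have hD := h.one_le_D
  calc φ 0 ρ = φ 0 (2 * (2 * (ρ / 4))) := by congr 1; ring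
    _ ≤ D * (D * φ 0 (ρ / 4)) := (h.doubling _ (by positivity)).trans (by
        gcongr; exact h.doubling _ (by positivity))
    _ ≤ D * (D * (K * φ 0 R)) := by
        gcongr; exact h.le_of_le hθ (by positivity) hR
    _ = _ := by ring

theorem volume_ball_mul {n : ℕ} (c c' : RSpace n) {k : ℝ} (hk : 0 < k) (r : ℝ) :
    volume (ball c (k * r)) = ENNReal.ofReal (k ^ n) * volume (ball c' r) := by
  rw [Measure.addHaar_ball_mul_of_pos volume c hk, Measure.addHaar_ball_center volume c']
  simp

theorem ball_ae_eq_closedBall {n : ℕ} (c : RSpace n) {r : ℝ} (hr : 0 < r) :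
    (ball c r : Set (RSpace n)) =ᵐ[volume] closedBall c r := by
  have := Measure.addHaar_sphere_of_ne_zero (volume : Measure (RSpace n)) c hr.ne'
  rw [← ball_union_sphere]
  exact (union_ae_eq_left_of_ae_eq_empty (ae_eq_empty.2 this)).symm

/-! ### Norm inequalities, duality and necessity of the condition -/

section Norms

variable {n : ℕ} {φ : RSpace n → ℝ → ℝ} {w : RSpace n → ℝ} {p : ℝ} {g : RSpace n → ℝ≥0∞}

theorem rpow_le_localMorreyNorm {R : ℝ} (hR : 0 < R) :
    ((∫⁻ x in ball 0 R, g x ^ p * ENNReal.ofReal (w x)) / ENNReal.ofReal (φ 0 R)) ^ (1 / p) ≤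
      localMorreyNorm φ w p g :=
  le_iSup₂_of_le R hR le_rfl

theorem setLIntegral_le_localMorreyNorm_rpow (hp : 0 < p) {R : ℝ} (hR : 0 < R)
    (hφ : 0 < φ 0 R) :
    ∫⁻ x in ball 0 R, g x ^ p * ENNReal.ofReal (w x) ≤
      localMorreyNorm φ w p g ^ p * ENNReal.ofReal (φ 0 R) := by
  have h := rpow_le_localMorreyNorm (φ := φ) (w := w) (p := p) (g := g) hR
  rw [one_div, ENNReal.rpow_inv_le_iff hp] at h
  exact (ENNReal.div_le_iff (by simpa using hφ) ENNReal.ofReal_ne_top).1 h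

theorem localMorreyNorm_le (hp : 0 < p) {C : ℝ≥0∞}
    (h : ∀ R, 0 < R → ∫⁻ x in ball 0 R, g x ^ p * ENNReal.ofReal (w x) ≤
      C ^ p * ENNReal.ofReal (φ 0 R)) : localMorreyNorm φ w p g ≤ C := by
  refine iSup₂_le fun R hR => ?_
  rw [one_div, ENNReal.rpow_inv_le_iff hp]
  exact ENNReal.div_le_of_le_mul (h R hR)

theorem weakLocalMorreyNorm_le (hp : 0 < p) {C : ℝ≥0∞}
    (h : ∀ R, 0 < R → ∀ t, 0 < t →
      ENNReal.ofReal t ^ p * weightMeasure w {x | x ∈ ball 0 R ∧ ENNReal.ofReal t < g x} ≤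
      C ^ p * ENNReal.ofReal (φ 0 R)) : weakLocalMorreyNorm φ w p g ≤ C := by
  refine iSup₂_le fun R hR => iSup₂_le fun t ht => ENNReal.div_le_of_le_mul ?_
  rw [← weightMeasure_apply, one_div]
  have hp' : 0 ≤ p⁻¹ := inv_nonneg.2 hp.le
  have := ENNReal.rpow_le_rpow (h R hR t ht) hp'
  rwa [ENNReal.mul_rpow_of_nonneg _ _ hp', ENNReal.mul_rpow_of_nonneg _ _ hp',
    ENNReal.rpow_rpow_inv hp.ne', ENNReal.rpow_rpow_inv hp.ne'] at this

theorem localMorreyNorm_const_mul (hp : 0 < p) {k : ℝ≥0∞} (hk : k ≠ ⊤) :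
    localMorreyNorm φ w p (fun x => k * g x) = k * localMorreyNorm φ w p g := by
  simp only [localMorreyNorm, ENNReal.mul_iSup]
  refine iSup_congr fun R => iSup_congr fun _ => ?_
  simp_rw [ENNReal.mul_rpow_of_nonneg _ _ hp.le, mul_assoc]
  rw [lintegral_const_mul' _ _ (ENNReal.rpow_ne_top_of_nonneg hp.le hk), mul_div_assoc,
    ENNReal.mul_rpow_of_nonneg _ _ (by positivity), one_div, ENNReal.rpow_rpow_inv hp.ne']

theorem lintegral_mul_charFn (c : RSpace n) (r : ℝ) (g : RSpace n → ℝ≥0∞) :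
    ∫⁻ x, g x * charFn (ball c r) x = ∫⁻ x in ball c r, g x := by
  rw [← lintegral_indicator isOpen_ball.measurableSet]
  refine lintegral_congr fun x => ?_
  by_cases hx : x ∈ ball c r <;> simp [charFn, hx]

theorem volume_ball_ne_zero (c : RSpace n) {r : ℝ} (hr : 0 < r) : volume (ball c r) ≠ 0 :=
  (measure_ball_pos volume c hr).ne'

theorem volume_ball_ne_top (c : RSpace n) (r : ℝ) : volume (ball c r) ≠ ⊤ :=
  measure_ball_lt_top.ne

/-- The duality inequality contained in the Muckenhoupt-type condition. -/
theorem setLIntegral_mul_localMorreyNorm_charFn_le (hp : 0 < p)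
    (hA : localMorreyAConst φ w p ≠ ⊤) {f : RSpace n → ℝ} (hf : AEMeasurable f volume)
    (hfN : localMorreyNorm φ w p (absFun f) ≠ ⊤) (c : RSpace n) {r : ℝ} (hr : 0 < r) :
    (∫⁻ x in ball c r, absFun f x) * localMorreyNorm φ w p (charFn (ball c r)) ≤
      localMorreyAConst φ w p * localMorreyNorm φ w p (absFun f) * volume (ball c r) := by
  set A := localMorreyAConst φ w p
  set X := ∫⁻ x in ball c r, absFun f x
  set Y := localMorreyNorm φ w p (charFn (ball c r))
  set V := volume (ball c r)
  have hV0 : V ≠ 0 := volume_ball_ne_zero c hr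
  have hVt : V ≠ ⊤ := volume_ball_ne_top c r
  have hdual : Y * kotheDualNorm (localMorreyNorm φ w p) (charFn (ball c r)) ≤ A * V := by
    rw [← ENNReal.div_le_iff hV0 hVt]
    exact le_iSup₂_of_le c r (le_iSup_of_le hr le_rfl)
  -- The dual norm tests only the unit ball, so f enters through its multiples: k = 1/‖f‖ in
  -- general, and every k when ‖f‖ = 0, in which case the left side must vanish.
  have hscale : ∀ k : ℝ≥0, k * localMorreyNorm φ w p (absFun f) ≤ 1 → k * (X * Y) ≤ A * V := by
    intro k hk
    have e : absFun (fun x => (k : ℝ) * f x) = fun x => (k : ℝ≥0∞) * absFun f x := by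
      ext x
      simp [absFun, enorm_mul]
    have hle : k * X ≤ kotheDualNorm (localMorreyNorm φ w p) (charFn (ball c r)) := by
      refine le_iSup₂_of_le (fun x => (k : ℝ) * f x) (hf.const_mul _) (le_iSup_of_le ?_ ?_)
      · rwa [e, localMorreyNorm_const_mul hp (by simp)]
      · rw [lintegral_mul_charFn, e, lintegral_const_mul' _ _ (by simp)]
    calc k * (X * Y) = Y * (k * X) := by ring
      _ ≤ _ := by gcongr
      _ ≤ _ := hdual
  rcases eq_or_ne (localMorreyNorm φ w p (absFun f)) 0 with h0 | h0
  · have hXY : X * Y = 0 := by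
      by_contra hne
      have hAV : A * V ≠ ⊤ := ENNReal.mul_ne_top hA hVt
      obtain ⟨k, hk⟩ := ENNReal.exists_nat_mul_gt hne hAV
      have := hscale k (by simp [h0])
      push_cast at this
      exact absurd hk (not_lt.2 this)
    simp [hXY]
  · have := hscale (localMorreyNorm φ w p (absFun f))⁻¹.toNNReal
    rw [ENNReal.coe_toNNReal (ENNReal.inv_ne_top.2 h0), ENNReal.inv_mul_cancel h0 hfN] at this
    have h1 := this le_rfl
    calc X * Y = localMorreyNorm φ w p (absFun f) *
          ((localMorreyNorm φ w p (absFun f))⁻¹ * (X * Y)) := by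
          rw [← mul_assoc, ENNReal.mul_inv_cancel h0 hfN, one_mul]
      _ ≤ localMorreyNorm φ w p (absFun f) * (A * V) := by gcongr
      _ = _ := by ring

theorem le_hlMaximal (f : RSpace n → ℝ) {c x : RSpace n} {r : ℝ} (hr : 0 < r)
    (hx : x ∈ ball c r) :
    (∫⁻ y in ball c r, absFun f y) / volume (ball c r) ≤ hlMaximal f x :=
  le_iSup₂_of_le c r (le_iSup₂_of_le hr hx le_rfl)

theorem setLIntegral_charFn_rpow (hp : 0 < p) (c : RSpace n) (r : ℝ) (s : Set (RSpace n)) :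
    ∫⁻ x in s, charFn (ball c r) x ^ p * ENNReal.ofReal (w x) =
      weightMeasure w (ball c r ∩ s) := by
  have e : ∀ x, charFn (ball c r) x ^ p * ENNReal.ofReal (w x) =
      (ball c r).indicator (fun x => ENNReal.ofReal (w x)) x := by
    intro x
    by_cases hx : x ∈ ball c r <;> simp [charFn, hx, hp]
  simp_rw [e]
  rw [lintegral_indicator isOpen_ball.measurableSet,
    Measure.restrict_restrict isOpen_ball.measurableSet, weightMeasure_apply]

/-- A weak type bound for the maximal operator bounds the Muckenhoupt-type constant. -/
theorem localMorreyAConst_le_of_isOperatorBound (hp : 0 < p) {C : ℝ≥0∞}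
    (hC : IsOperatorBound hlMaximal (localMorreyNorm φ w p) (weakLocalMorreyNorm φ w p) C) :
    localMorreyAConst φ w p ≤ C := by
  refine iSup₂_le fun c r => iSup_le fun hr => ?_
  simp only [kotheDualNorm, ENNReal.mul_iSup, ENNReal.iSup_div]
  refine iSup₂_le fun f hf => iSup_le fun hfN => ?_
  rw [lintegral_mul_charFn, mul_div_assoc, localMorreyNorm]
  simp only [ENNReal.iSup_mul]
  refine iSup₂_le fun R hR => ?_
  rw [mul_comm]
  -- Levels a strictly below the average are used because the weak norm has the strict superlevel
  -- set {Mf > a}; for such a it contains the whole ball.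
  refine ENNReal.mul_le_of_forall_lt fun a ha b hb => ?_
  have hp' : 0 < 1 / p := by positivity
  have hat : a ≠ ⊤ := ha.ne_top
  rcases eq_or_ne a 0 with rfl | ha0
  · simp
  have ht : 0 < a.toReal := ENNReal.toReal_pos ha0 hat
  have hWN := hC f hf (hfN.trans_lt ENNReal.one_lt_top)
  calc a * b ≤ ENNReal.ofReal a.toReal * (∫⁻ x in {x | x ∈ ball 0 R ∧
          ENNReal.ofReal a.toReal < hlMaximal f x}, ENNReal.ofReal (w x)) ^ (1 / p) /
        ENNReal.ofReal (φ 0 R) ^ (1 / p) := by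
        rw [ENNReal.ofReal_toReal hat, mul_div_assoc, ← ENNReal.div_rpow_of_nonneg _ _ hp'.le]
        refine mul_le_mul_right (hb.le.trans ?_) a
        refine ENNReal.rpow_le_rpow (ENNReal.div_le_div_right ?_ _) hp'.le
        rw [setLIntegral_charFn_rpow hp, weightMeasure_apply]
        refine lintegral_mono_set fun x hx => ⟨hx.2, ha.trans_le (le_hlMaximal f hr hx.1)⟩
    _ ≤ weakLocalMorreyNorm φ w p (hlMaximal f) :=
        le_iSup₂_of_le R hR (le_iSup₂_of_le a.toReal ht le_rfl)
    _ ≤ C * localMorreyNorm φ w p (absFun f) := hWN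
    _ ≤ C := mul_le_of_le_one_right zero_le hfN

/-- Each superlevel set is a union of open balls, hence open. -/
theorem measurable_hlMaximal (f : RSpace n → ℝ) : Measurable (hlMaximal f) := by
  refine measurable_of_Ioi fun a => IsOpen.measurableSet ?_
  have : hlMaximal f ⁻¹' Set.Ioi a = ⋃ (c : RSpace n) (r : ℝ) (_ : 0 < r)
      (_ : a < (∫⁻ y in ball c r, absFun f y) / volume (ball c r)), ball c r := by
    ext x
    simp only [hlMaximal, Set.mem_preimage, Set.mem_Ioi, lt_iSup_iff, Set.mem_iUnion]
    constructor
    · rintro ⟨c, r, h1, h2, h3⟩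
      exact ⟨c, r, h1, h3, h2⟩
    · rintro ⟨c, r, h1, h2, h3⟩
      exact ⟨c, r, h1, h3, h2⟩
  rw [this]
  exact isOpen_iUnion fun c => isOpen_iUnion fun r => isOpen_iUnion fun _ =>
    isOpen_iUnion fun _ => isOpen_ball

/-- Chebyshev's inequality for local Morrey norms. -/
theorem weakLocalMorreyNorm_le_localMorreyNorm (hp : 0 < p)
    (hφ : ∀ R, 0 < R → 0 < φ 0 R) (hg : Measurable g) :
    weakLocalMorreyNorm φ w p g ≤ localMorreyNorm φ w p g := by
  refine weakLocalMorreyNorm_le hp fun R hR t ht => ?_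
  refine le_trans ?_ (setLIntegral_le_localMorreyNorm_rpow hp hR (hφ R hR))
  have hS : MeasurableSet {x | x ∈ ball 0 R ∧ ENNReal.ofReal t < g x} :=
    isOpen_ball.measurableSet.inter (measurableSet_lt measurable_const hg)
  calc _ = ∫⁻ x in {x | x ∈ ball 0 R ∧ ENNReal.ofReal t < g x},
        ENNReal.ofReal t ^ p * ENNReal.ofReal (w x) := by
        rw [weightMeasure_apply, lintegral_const_mul' _ _
          (ENNReal.rpow_ne_top_of_nonneg hp.le ENNReal.ofReal_ne_top)]
    _ ≤ ∫⁻ x in {x | x ∈ ball 0 R ∧ ENNReal.ofReal t < g x}, g x ^ p * ENNReal.ofReal (w x) := by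
        refine setLIntegral_mono' hS fun x hx => ?_
        gcongr
        exact hx.2.le
    _ ≤ _ := lintegral_mono_set fun x hx => hx.1

end Norms

/-! ### Small and large balls near a shell -/

section LocalEstimates

variable {n : ℕ} {φ : RSpace n → ℝ → ℝ} {w : RSpace n → ℝ} {p D K θ : ℝ}

theorem absFun_indicator (s : Set (RSpace n)) (f : RSpace n → ℝ) (x : RSpace n) :
    absFun (s.indicator f) x = s.indicator (absFun f) x := by
  by_cases hx : x ∈ s <;> simp [absFun, hx]

/-- On balls away from the origin the Muckenhoupt-type condition gives a testing form of the
classical one. -/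
theorem setLIntegral_rpow_mul_weightMeasure_le (hG : CenteredGrowth φ D K θ) (hθ : 0 ≤ θ)
    (hp : 0 < p) (hA : localMorreyAConst φ w p ≠ ⊤) {ρ : ℝ} (hρ : 0 < ρ) {c : RSpace n} {s : ℝ}
    (hs : 0 < s) (hsub : ball c s ⊆ ball 0 (2 * ρ)) (hdisj : ∀ x ∈ ball c s, ρ / 4 ≤ ‖x‖)
    {f : RSpace n → ℝ} (hf : AEMeasurable f volume)
    (hfi : ∫⁻ x in ball c s, absFun f x ^ p * ENNReal.ofReal (w x) ≠ ⊤) :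
    (∫⁻ x in ball c s, absFun f x) ^ p * weightMeasure w (ball c s) ≤
      localMorreyAConst φ w p ^ p * ENNReal.ofReal (D ^ 3 * K) *
        (∫⁻ x in ball c s, absFun f x ^ p * ENNReal.ofReal (w x)) * volume (ball c s) ^ p := by
  set A := localMorreyAConst φ w p
  set I := ∫⁻ x in ball c s, absFun f x ^ p * ENNReal.ofReal (w x)
  set V := volume (ball c s)
  set X := ∫⁻ x in ball c s, absFun f x
  have hD := hG.one_le_D
  have hK := hG.one_le_K
  have hΦ := hG.pos ρ hρ
  have hΦ0 : ENNReal.ofReal (φ 0 ρ) ≠ 0 := by simpa using hΦ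
  set Φ := ENNReal.ofReal (φ 0 ρ)
  have hp' : 0 ≤ p⁻¹ := inv_nonneg.2 hp.le
  set f₁ := (ball c s).indicator f
  have hf₁ : AEMeasurable f₁ volume := hf.indicator isOpen_ball.measurableSet
  have hX : ∫⁻ x in ball c s, absFun f₁ x = X := by
    refine setLIntegral_congr_fun isOpen_ball.measurableSet fun x hx => ?_
    rw [absFun_indicator, Set.indicator_of_mem hx]
  -- The truncated function vanishes on B(0,R) for R < ρ/4. For the remaining R the value φ(B(0,ρ))
  -- is at most D²K φ(B(0,R)).
  have hf₁N : localMorreyNorm φ w p (absFun f₁) ≤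
      (I * ENNReal.ofReal (D ^ 2 * K) / Φ) ^ p⁻¹ := by
    refine localMorreyNorm_le hp fun R hR => ?_
    rw [ENNReal.rpow_inv_rpow hp.ne']
    have e : ∀ x, absFun f₁ x ^ p * ENNReal.ofReal (w x) =
        (ball c s).indicator (fun x => absFun f x ^ p * ENNReal.ofReal (w x)) x := by
      intro x
      rw [absFun_indicator]
      by_cases hx : x ∈ ball c s <;> simp [hx, hp]
    simp_rw [e]
    rw [lintegral_indicator isOpen_ball.measurableSet,
      Measure.restrict_restrict isOpen_ball.measurableSet]
    rcases lt_or_ge R (ρ / 4) with h | h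
    · have : ball c s ∩ ball 0 R = ∅ := by
        ext x
        simp only [Set.mem_inter_iff, mem_ball_zero_iff, Set.mem_empty_iff_false, iff_false,
          not_and, not_lt]
        exact fun hx => h.le.trans (hdisj x hx)
      simp [this]
    · have h1 : Φ ≤ ENNReal.ofReal (D ^ 2 * K) * ENNReal.ofReal (φ 0 R) := by
        rw [← ENNReal.ofReal_mul (by positivity)]
        exact ENNReal.ofReal_le_ofReal (hG.le_of_quarter_le hθ hρ h)
      calc _ ≤ I := lintegral_mono_set Set.inter_subset_left
        _ = I * (Φ / Φ) := by rw [ENNReal.div_self hΦ0 ENNReal.ofReal_ne_top, mul_one]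
        _ ≤ I * ((ENNReal.ofReal (D ^ 2 * K) * ENNReal.ofReal (φ 0 R)) / Φ) := by gcongr
        _ = _ := by simp only [div_eq_mul_inv]; ring
  have hf₁top : localMorreyNorm φ w p (absFun f₁) ≠ ⊤ := by
    refine ne_top_of_le_ne_top (ENNReal.rpow_ne_top_of_nonneg hp' ?_) hf₁N
    exact ENNReal.div_ne_top (ENNReal.mul_ne_top hfi ENNReal.ofReal_ne_top) hΦ0
  -- The single radius 2ρ suffices, since B(0,2ρ) contains the ball. It costs one doubling factor D,
  -- which with the D²K above makes D³K.
  have hχ : (weightMeasure w (ball c s) / (ENNReal.ofReal D * Φ)) ^ p⁻¹ ≤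
      localMorreyNorm φ w p (charFn (ball c s)) := by
    refine le_trans ?_ (rpow_le_localMorreyNorm (R := 2 * ρ) (by positivity))
    rw [setLIntegral_charFn_rpow hp, Set.inter_eq_left.2 hsub, one_div]
    gcongr
    rw [← ENNReal.ofReal_mul (by positivity)]
    exact ENNReal.ofReal_le_ofReal (hG.doubling ρ hρ)
  have hkey := setLIntegral_mul_localMorreyNorm_charFn_le hp hA hf₁ hf₁top c hs
  rw [hX] at hkey
  have hkey2 : X * (weightMeasure w (ball c s) / (ENNReal.ofReal D * Φ)) ^ p⁻¹ ≤
      A * (I * ENNReal.ofReal (D ^ 2 * K) / Φ) ^ p⁻¹ * V :=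
    le_trans (by gcongr) (hkey.trans (by gcongr))
  have hkey3 := ENNReal.rpow_le_rpow hkey2 hp.le
  simp only [ENNReal.mul_rpow_of_nonneg _ _ hp.le, ENNReal.rpow_inv_rpow hp.ne'] at hkey3
  have hD0 : ENNReal.ofReal D ≠ 0 := by simp; linarith
  have hDΦ0 : ENNReal.ofReal D * Φ ≠ 0 := mul_ne_zero hD0 hΦ0
  have hDΦt : ENNReal.ofReal D * Φ ≠ ⊤ := ENNReal.mul_ne_top ENNReal.ofReal_ne_top ENNReal.ofReal_ne_top
  have hDK : ENNReal.ofReal (D ^ 3 * K) = ENNReal.ofReal D * ENNReal.ofReal (D ^ 2 * K) := by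
    rw [← ENNReal.ofReal_mul (by positivity)]
    congr 1
    ring
  calc X ^ p * weightMeasure w (ball c s)
      = (ENNReal.ofReal D * Φ) * (X ^ p * (weightMeasure w (ball c s) / (ENNReal.ofReal D * Φ))) := by
        rw [mul_left_comm, ENNReal.mul_div_cancel hDΦ0 hDΦt]
    _ ≤ (ENNReal.ofReal D * Φ) * (A ^ p * (I * ENNReal.ofReal (D ^ 2 * K) / Φ) * V ^ p) := by gcongr
    _ = A ^ p * ENNReal.ofReal D * (Φ * (I * ENNReal.ofReal (D ^ 2 * K) / Φ)) * V ^ p := by ring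
    _ = _ := by
        rw [ENNReal.mul_div_cancel hΦ0 ENNReal.ofReal_ne_top, hDK]
        ring

/-- The supremum of the averages of `|f|` over balls of radius `> ρ / 32` meeting `B(0, ρ)`. -/
noncomputable def largeBallMaximal (f : RSpace n → ℝ) (ρ : ℝ) : ℝ≥0∞ :=
  ⨆ (c : RSpace n) (s : ℝ) (_ : ρ / 32 < s) (_ : (ball c s ∩ ball 0 ρ).Nonempty),
    (∫⁻ y in ball c s, absFun f y) / volume (ball c s)

/-- A ball of radius s > ρ/32 meeting B(0,ρ) has all its points at norm below 2s + ρ < 34s. The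
duality inequality is applied on B(0,34s), where testing ‖χ‖ at radius ρ produces
w(B(0,ρ))/φ(B(0,ρ)). The price is the volume ratio 34^n. -/
theorem largeBallMaximal_rpow_mul_le (hG : CenteredGrowth φ D K θ) (hp : 0 < p)
    (hA : localMorreyAConst φ w p ≠ ⊤) {ρ : ℝ} (hρ : 0 < ρ) {f : RSpace n → ℝ}
    (hf : AEMeasurable f volume) (hfN : localMorreyNorm φ w p (absFun f) ≠ ⊤) :
    largeBallMaximal f ρ ^ p * weightMeasure w (ball 0 ρ) ≤
      (34 ^ n * localMorreyAConst φ w p * localMorreyNorm φ w p (absFun f)) ^ p *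
        ENNReal.ofReal (φ 0 ρ) := by
  have hΦ0 : ENNReal.ofReal (φ 0 ρ) ≠ 0 := by simpa using hG.pos ρ hρ
  have hmain : largeBallMaximal f ρ *
      (weightMeasure w (ball 0 ρ) / ENNReal.ofReal (φ 0 ρ)) ^ p⁻¹ ≤
      34 ^ n * localMorreyAConst φ w p * localMorreyNorm φ w p (absFun f) := by
    simp only [largeBallMaximal, ENNReal.iSup_mul]
    refine iSup₂_le fun c s => iSup₂_le fun hs hne => ?_
    obtain ⟨z, hz, hz0⟩ := hne
    have hs0 : 0 < s := lt_trans (by positivity) hs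
    have hsub : ball c s ⊆ ball 0 (34 * s) := by
      intro y hy
      rw [mem_ball_zero_iff] at hz0 ⊢
      rw [mem_ball] at hy hz
      have h1 := dist_triangle_right y z c
      have h2 : ‖y‖ ≤ dist y z + ‖z‖ := by
        rw [dist_eq_norm]; simpa using norm_add_le (y - z) z
      linarith
    have hsub2 : ball (0 : RSpace n) ρ ⊆ ball 0 (34 * s) := ball_subset_ball (by linarith)
    have hχ : (weightMeasure w (ball 0 ρ) / ENNReal.ofReal (φ 0 ρ)) ^ p⁻¹ ≤
        localMorreyNorm φ w p (charFn (ball 0 (34 * s))) := by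
      refine le_trans ?_ (rpow_le_localMorreyNorm hρ)
      rw [setLIntegral_charFn_rpow hp, Set.inter_eq_right.2 hsub2, one_div]
    have hkey := setLIntegral_mul_localMorreyNorm_charFn_le hp hA hf hfN 0
      (r := 34 * s) (by positivity)
    have hV : volume (ball (0 : RSpace n) (34 * s)) = 34 ^ n * volume (ball c s) := by
      rw [volume_ball_mul 0 c (by norm_num)]
      norm_num
    rw [hV] at hkey
    have hV0 := volume_ball_ne_zero c hs0
    have hVt := volume_ball_ne_top c s
    rw [ENNReal.mul_comm_div, ← mul_div_assoc, ENNReal.div_le_iff hV0 hVt]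
    calc _ ≤ (∫⁻ y in ball 0 (34 * s), absFun f y) *
          localMorreyNorm φ w p (charFn (ball 0 (34 * s))) := by
          gcongr
      _ ≤ _ := hkey
      _ = _ := by ring
  have h := ENNReal.rpow_le_rpow hmain hp.le
  rw [ENNReal.mul_rpow_of_nonneg _ _ hp.le, ENNReal.rpow_inv_rpow hp.ne', ← mul_div_assoc] at h
  exact (ENNReal.div_le_iff hΦ0 ENNReal.ofReal_ne_top).1 h

/-- The spherical shell `ρ / 2 ≤ |x| < ρ`. -/
def shell (n : ℕ) (ρ : ℝ) : Set (RSpace n) := {x | ρ / 2 ≤ ‖x‖ ∧ ‖x‖ < ρ}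

theorem measurableSet_shell (ρ : ℝ) : MeasurableSet (shell n ρ) :=
  (measurableSet_le measurable_const measurable_norm).inter
    (measurableSet_lt measurable_norm measurable_const)

theorem ball_subset_of_mem_shell {ρ : ℝ} {x : RSpace n} (hx : x ∈ shell n ρ) {s : ℝ}
    (hs : s ≤ ρ / 4) : ball x s ⊆ ball 0 (2 * ρ) ∧ ∀ y ∈ ball x s, ρ / 4 ≤ ‖y‖ := by
  have aux : ∀ y ∈ ball x s, ‖y‖ < ‖x‖ + ρ / 4 ∧ ‖x‖ - ρ / 4 < ‖y‖ := by
    intro y hy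
    rw [mem_ball, dist_eq_norm] at hy
    have h1 := abs_norm_sub_norm_le y x
    rw [abs_le] at h1
    constructor <;> linarith
  refine ⟨fun y hy => ?_, fun y hy => ?_⟩
  · rw [mem_ball_zero_iff]
    linarith [(aux y hy).1, hx.2, norm_nonneg x]
  · linarith [(aux y hy).2, hx.1]

theorem closedBall_subset_of_mem_shell {ρ : ℝ} (hρ : 0 < ρ) {x : RSpace n} (hx : x ∈ shell n ρ)
    (m : ℕ) : closedBall x (ρ / 16 / 2 ^ m) ⊆ ball 0 (2 * ρ) := by
  refine (closedBall_subset_ball ?_).trans (ball_subset_of_mem_shell hx le_rfl).1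
  have : ρ / 16 / 2 ^ m ≤ ρ / 16 := div_le_self (by positivity) (one_le_pow₀ (by norm_num))
  linarith

/-- On a shell the maximal operator is controlled by a centered maximal operator along small
balls and by the averages over large balls. -/
theorem hlMaximal_le_max_of_mem_shell {ρ : ℝ} (hρ : 0 < ρ) (f : RSpace n → ℝ) {x : RSpace n}
    (hx : x ∈ shell n ρ) :
    hlMaximal f x ≤ max (4 ^ n * centeredMaximal volume (ρ / 16)
      ((ball 0 (2 * ρ)).indicator (absFun f)) x) (largeBallMaximal f ρ) := by
  refine iSup₂_le fun c s => iSup₂_le fun hs hxs => ?_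
  rcases lt_or_ge (ρ / 32) s with h | h
  · refine le_max_of_le_right (le_iSup₂_of_le c s (le_iSup₂_of_le h ⟨x, hxs, ?_⟩ le_rfl))
    exact mem_ball_zero_iff.2 hx.2
  · refine le_max_of_le_left ?_
    -- This m gives 2s ≤ r < 4s for r = ρ/16/2^m. The lower bound puts the ball inside the one
    -- centered at x, and the upper bound limits the volume ratio to 4^n. The cutoff s ≤ ρ/32 is
    -- what makes m ≥ 0 possible.
    obtain ⟨m, hm1, hm2⟩ := exists_nat_pow_near (x := ρ / 16 / (2 * s)) (y := 2)
      (by rw [one_le_div (by positivity)]; linarith) one_lt_two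
    have h2m : (0 : ℝ) < 2 ^ m := by positivity
    set r := ρ / 16 / 2 ^ m with hr
    have hr0 : 0 < r := by positivity
    have hsr : 2 * s ≤ r := by
      rw [hr, le_div_iff₀ h2m]
      rw [le_div_iff₀ (by positivity)] at hm1
      linarith
    have hrs : r < 4 * s := by
      rw [hr, div_lt_iff₀ h2m]
      rw [div_lt_iff₀ (by positivity), pow_succ] at hm2
      linarith
    have hsub : ball c s ⊆ closedBall x r := by
      intro y hy
      rw [mem_ball] at hy hxs
      rw [mem_closedBall]
      have := dist_triangle_right y x c
      linarith
    have hV : volume (closedBall x r) ≤ 4 ^ n * volume (ball c s) := by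
      calc volume (closedBall x r) = volume (ball x r) :=
            (measure_congr (ball_ae_eq_closedBall x hr0)).symm
        _ ≤ volume (ball x (4 * s)) := measure_mono (ball_subset_ball hrs.le)
        _ = _ := by rw [volume_ball_mul x c (by norm_num)]; norm_num
    have hV0 := volume_ball_ne_zero c hs
    have hVt := volume_ball_ne_top c s
    have hVr0 : volume (closedBall x r) ≠ 0 := (measure_closedBall_pos volume x hr0).ne'
    have hVrt : volume (closedBall x r) ≠ ⊤ := measure_closedBall_lt_top.ne
    calc (∫⁻ y in ball c s, absFun f y) / volume (ball c s)
        ≤ 4 ^ n * ((∫⁻ y in closedBall x r, (ball 0 (2 * ρ)).indicator (absFun f) y) /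
          volume (closedBall x r)) := by
          rw [setLIntegral_congr_fun isClosed_closedBall.measurableSet
            (g := absFun f) fun y hy => Set.indicator_of_mem
              (closedBall_subset_of_mem_shell hρ hx m hy) _]
          rw [ENNReal.div_le_iff hV0 hVt]
          calc _ ≤ ∫⁻ y in closedBall x r, absFun f y := lintegral_mono_set hsub
            _ = (∫⁻ y in closedBall x r, absFun f y) / volume (closedBall x r) *
                volume (closedBall x r) := (ENNReal.div_mul_cancel hVr0 hVrt).symm
            _ ≤ (∫⁻ y in closedBall x r, absFun f y) / volume (closedBall x r) *
                (4 ^ n * volume (ball c s)) := by gcongr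
            _ = _ := by ring
      _ ≤ _ := by
          gcongr
          exact le_iSup (fun m : ℕ => (∫⁻ y in closedBall x (ρ / 16 / 2 ^ m),
            (ball 0 (2 * ρ)).indicator (absFun f) y) / volume (closedBall x (ρ / 16 / 2 ^ m))) m

end LocalEstimates

/-! ### Summation over dyadic shells -/

theorem ball_subset_iUnion_shell {n : ℕ} {R : ℝ} :
    ball (0 : RSpace n) R ⊆ {0} ∪ ⋃ i : ℕ, shell n (R / 2 ^ i) := by
  intro x hx
  rw [mem_ball_zero_iff] at hx
  rcases eq_or_ne x 0 with rfl | hx0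
  · exact Or.inl rfl
  right
  rw [Set.mem_iUnion]
  have hx' : 0 < ‖x‖ := norm_pos_iff.2 hx0
  obtain ⟨m, hm1, hm2⟩ := exists_nat_pow_near (x := R / ‖x‖) (y := 2)
    ((one_le_div hx').2 hx.le) one_lt_two
  rw [le_div_iff₀ hx'] at hm1
  rw [div_lt_iff₀ hx'] at hm2
  rcases hm1.lt_or_eq with h | h
  · refine ⟨m, ?_, ?_⟩
    · rw [div_div, ← pow_succ, div_le_iff₀ (by positivity)]
      linarith
    · rw [lt_div_iff₀ (by positivity)]
      linarith
  -- Here |x| = R/2^m lies on the excluded outer sphere of shell m, hence on the inner sphere of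
  -- shell m - 1. For m = 0 it would lie outside the open ball.
  · cases m with
    | zero => simp at h; linarith
    | succ k =>
      have hk : (0 : ℝ) < 2 ^ k := by positivity
      refine ⟨k, ?_, ?_⟩
      · rw [div_div, ← pow_succ, div_le_iff₀ (by positivity)]
        linarith
      · rw [lt_div_iff₀ hk]
        rw [pow_succ] at h
        nlinarith

/-- The constant arising from summing a reverse doubling function over shells. -/
noncomputable def shellSum (K θ : ℝ) : ℝ≥0∞ :=
  ENNReal.ofReal K * (1 - ENNReal.ofReal ((1 / 2) ^ θ))⁻¹

theorem shellSum_ne_top {K θ : ℝ} (hθ : 0 < θ) : shellSum K θ ≠ ⊤ := by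
  refine ENNReal.mul_ne_top ENNReal.ofReal_ne_top (ENNReal.inv_ne_top.2 ?_)
  rw [Ne, tsub_eq_zero_iff_le, not_le, ENNReal.ofReal_lt_one]
  exact Real.rpow_lt_one (by norm_num) (by norm_num) hθ

theorem shellSum_ne_zero {K θ : ℝ} (hK : 1 ≤ K) : shellSum K θ ≠ 0 := by
  refine mul_ne_zero ?_ (ENNReal.inv_ne_zero.2 (by finiteness))
  simp; linarith

/-- Measures controlled on shells by a reverse doubling function are controlled on balls. -/
theorem measure_ball_le_of_shell {n : ℕ} {φ : RSpace n → ℝ → ℝ} {D K θ : ℝ}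
    (hG : CenteredGrowth φ D K θ) (ν : Measure (RSpace n)) (hν : ν {0} = 0) {a : ℝ≥0∞}
    (h : ∀ ρ, 0 < ρ → ν (shell n ρ) ≤ a * ENNReal.ofReal (φ 0 ρ)) {R : ℝ} (hR : 0 < R) :
    ν (ball 0 R) ≤ a * shellSum K θ * ENNReal.ofReal (φ 0 R) := by
  have hK := hG.one_le_K
  calc ν (ball 0 R) ≤ ν ({0} ∪ ⋃ i : ℕ, shell n (R / 2 ^ i)) :=
        measure_mono ball_subset_iUnion_shell
    _ ≤ ν {0} + ν (⋃ i : ℕ, shell n (R / 2 ^ i)) := measure_union_le _ _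
    _ ≤ ∑' i : ℕ, ν (shell n (R / 2 ^ i)) := by
        rw [hν, zero_add]; exact measure_iUnion_le _
    -- Reverse doubling gives φ(B(0,R/2^i)) ≤ K 2^(-iθ) φ(B(0,R)), and θ > 0 makes this a convergent
    -- geometric series.
    _ ≤ ∑' i : ℕ, a * ENNReal.ofReal K * ENNReal.ofReal (φ 0 R) *
          ENNReal.ofReal ((1 / 2) ^ θ) ^ i := by
        refine ENNReal.tsum_le_tsum fun i => (h _ (by positivity)).trans ?_
        rw [mul_assoc, mul_assoc]
        gcongr
        rw [← ENNReal.ofReal_pow (by positivity), ← ENNReal.ofReal_mul (hG.pos R hR).le,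
          ← ENNReal.ofReal_mul (by linarith)]
        refine ENNReal.ofReal_le_ofReal ((hG.reverse (R / 2 ^ i) R (by positivity)
          (div_le_self hR.le (one_le_pow₀ (by norm_num)))).trans (le_of_eq ?_))
        have : R / 2 ^ i / R = (1 / 2) ^ i := by
          rw [div_pow, one_pow]; field_simp
        rw [this, ← Real.rpow_natCast, ← Real.rpow_natCast, ← Real.rpow_mul (by norm_num),
          ← Real.rpow_mul (by norm_num), mul_comm (i : ℝ)]
        ring
    _ = _ := by
        rw [ENNReal.tsum_mul_left, ENNReal.tsum_geometric, shellSum]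
        ring

/-! ### The weak type estimate -/

section Weak

variable {n : ℕ} {φ : RSpace n → ℝ → ℝ} {w : RSpace n → ℝ} {p D K θ : ℝ}

/-- Each point of the superlevel set is the center of a ball B whose average of |f| exceeds t/4^n,
and the local A_p condition turns this into t^p w(B) ≤ k ∫_B |f|^p w. Besicovitch then bounds the
left measure of the set by the total mass of the right one on B(0,2ρ), and the last factor D passes
from φ(B(0,2ρ)) to φ(B(0,ρ)). -/
theorem weak_centeredMaximal_shell {Nb : ℕ}
    (hNb : ∀ (μ ν : Measure (RSpace n)) (A : Set (RSpace n)) (ρ : ℝ),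
      (∀ x ∈ A, ∃ r, 0 < r ∧ r ≤ ρ ∧ μ (closedBall x r) ≤ ν (closedBall x r)) →
        μ A ≤ Nb * ν Set.univ)
    (hG : CenteredGrowth φ D K θ) (hθ : 0 ≤ θ) (hp : 0 < p)
    (hA : localMorreyAConst φ w p ≠ ⊤) {ρ : ℝ} (hρ : 0 < ρ) {f : RSpace n → ℝ}
    (hf : AEMeasurable f volume) (hfN : localMorreyNorm φ w p (absFun f) ≠ ⊤) (t : ℝ) :
    ENNReal.ofReal t ^ p * weightMeasure w {x | x ∈ shell n ρ ∧ ENNReal.ofReal t <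
        4 ^ n * centeredMaximal volume (ρ / 16) ((ball 0 (2 * ρ)).indicator (absFun f)) x} ≤
      Nb * (4 ^ n) ^ p * ENNReal.ofReal (D ^ 3 * K) * ENNReal.ofReal D *
        (localMorreyAConst φ w p * localMorreyNorm φ w p (absFun f)) ^ p *
          ENNReal.ofReal (φ 0 ρ) := by
  set A := localMorreyAConst φ w p
  have hD := hG.one_le_D
  set k : ℝ≥0∞ := (4 ^ n) ^ p * A ^ p * ENNReal.ofReal (D ^ 3 * K) with hk
  set u : RSpace n → ℝ≥0∞ := fun x => absFun f x ^ p * ENNReal.ofReal (w x) with hu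
  set ν := k • (volume.restrict (ball 0 (2 * ρ))).withDensity u
  have hI : ∫⁻ x in ball 0 (2 * ρ), u x ≤
      localMorreyNorm φ w p (absFun f) ^ p * ENNReal.ofReal (φ 0 (2 * ρ)) :=
    setLIntegral_le_localMorreyNorm_rpow hp (by positivity) (hG.pos _ (by positivity))
  have hcov := hNb (ENNReal.ofReal t ^ p • weightMeasure w) ν {x | x ∈ shell n ρ ∧
    ENNReal.ofReal t < 4 ^ n * centeredMaximal volume (ρ / 16)
      ((ball 0 (2 * ρ)).indicator (absFun f)) x} (ρ / 16) ?_
  · rw [Measure.smul_apply, smul_eq_mul] at hcov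
    refine hcov.trans ?_
    rw [Measure.smul_apply, smul_eq_mul, withDensity_apply _ MeasurableSet.univ,
      Measure.restrict_univ]
    calc _ ≤ Nb * (k * (localMorreyNorm φ w p (absFun f) ^ p *
          (ENNReal.ofReal D * ENNReal.ofReal (φ 0 ρ)))) := by
          gcongr
          refine hI.trans ?_
          gcongr
          rw [← ENNReal.ofReal_mul (by positivity)]
          exact ENNReal.ofReal_le_ofReal (hG.doubling ρ hρ)
      _ = _ := by
          rw [hk, ENNReal.mul_rpow_of_nonneg _ _ hp.le]
          ring
  · rintro x ⟨hx, hxt⟩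
    rw [centeredMaximal, ENNReal.mul_iSup, lt_iSup_iff] at hxt
    obtain ⟨m, hm⟩ := hxt
    have hrle : ρ / 16 / 2 ^ m ≤ ρ / 16 := div_le_self (by positivity) (one_le_pow₀ (by norm_num))
    have hcb := closedBall_subset_of_mem_shell hρ hx m
    set r := ρ / 16 / 2 ^ m
    have hr0 : 0 < r := by positivity
    refine ⟨r, hr0, hrle, ?_⟩
    rw [setLIntegral_congr_fun isClosed_closedBall.measurableSet
      (g := absFun f) fun y hy => Set.indicator_of_mem (hcb hy) _] at hm
    -- Besicovitch uses closed balls and the weight condition open ones; spheres are null, so the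
    -- two agree.
    have hres : volume.restrict (closedBall x r) = volume.restrict (ball x r) :=
      (Measure.restrict_congr_set (ball_ae_eq_closedBall x hr0)).symm
    have hvol : volume (closedBall x r) = volume (ball x r) :=
      (measure_congr (ball_ae_eq_closedBall x hr0)).symm
    have hW : weightMeasure w (closedBall x r) = weightMeasure w (ball x r) := by
      rw [weightMeasure_apply, weightMeasure_apply, hres]
    obtain ⟨hs1, hs2⟩ := ball_subset_of_mem_shell (s := r) hx (by linarith)
    rw [Measure.smul_apply, Measure.smul_apply, smul_eq_mul, smul_eq_mul, hW,
      withDensity_apply _ isClosed_closedBall.measurableSet,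
      Measure.restrict_restrict isClosed_closedBall.measurableSet,
      Set.inter_eq_left.2 hcb, hres]
    rw [hres, hvol] at hm
    set V := volume (ball x r)
    have hV0 : V ≠ 0 := volume_ball_ne_zero x hr0
    have hVt : V ≠ ⊤ := volume_ball_ne_top x r
    have hfi : ∫⁻ y in ball x r, absFun f y ^ p * ENNReal.ofReal (w y) ≠ ⊤ := by
      refine ne_top_of_le_ne_top (ENNReal.mul_ne_top
        (ENNReal.rpow_ne_top_of_nonneg hp.le hfN) ENNReal.ofReal_ne_top)
        ((lintegral_mono_set hs1).trans hI)
    have hkey := setLIntegral_rpow_mul_weightMeasure_le hG hθ hp hA hρ hr0 hs1 hs2 hf hfi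
    have hm' : ENNReal.ofReal t * V ≤ 4 ^ n * ∫⁻ y in ball x r, absFun f y := by
      rw [← mul_div_assoc] at hm
      exact ENNReal.mul_le_of_le_div hm.le
    have hm2 := ENNReal.rpow_le_rpow hm' hp.le
    rw [ENNReal.mul_rpow_of_nonneg _ _ hp.le, ENNReal.mul_rpow_of_nonneg _ _ hp.le] at hm2
    have hVp0 : V ^ p ≠ 0 := (ENNReal.rpow_pos (pos_iff_ne_zero.2 hV0) hVt).ne'
    have hVpt : V ^ p ≠ ⊤ := ENNReal.rpow_ne_top_of_nonneg hp.le hVt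
    rw [← ENNReal.mul_le_mul_iff_left hVp0 hVpt]
    calc _ = ENNReal.ofReal t ^ p * V ^ p * weightMeasure w (ball x r) := by ring
      _ ≤ (4 ^ n) ^ p * (∫⁻ y in ball x r, absFun f y) ^ p * weightMeasure w (ball x r) := by
          gcongr
      _ = (4 ^ n) ^ p * ((∫⁻ y in ball x r, absFun f y) ^ p * weightMeasure w (ball x r)) := by
          ring
      _ ≤ (4 ^ n) ^ p * (A ^ p * ENNReal.ofReal (D ^ 3 * K) * (∫⁻ y in ball x r, u y) * V ^ p) :=
          mul_le_mul_right hkey _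
      _ = _ := by rw [hk]; ring

/-- The weak type estimate, with a bound linear in the Muckenhoupt-type constant. -/
theorem exists_weakLocalMorreyNorm_hlMaximal_le (hn : 1 ≤ n) (hp : 0 < p) (hK : 1 ≤ K)
    (hθ : 0 < θ) :
    ∃ C : ℝ≥0, 0 < C ∧ ∀ φ : RSpace n → ℝ → ℝ, CenteredGrowth φ D K θ →
      ∀ w : RSpace n → ℝ, localMorreyAConst φ w p ≠ ⊤ →
      IsOperatorBound hlMaximal (localMorreyNorm φ w p) (weakLocalMorreyNorm φ w p)
        (C * localMorreyAConst φ w p) := by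
  obtain ⟨Nb, hNb⟩ := exists_besicovitch_const n
  -- The first summand pays for small balls on a shell, the second for large ones. Neither involves
  -- w, so the final bound stays linear in the weight constant.
  set c : ℝ≥0∞ := Nb * (4 ^ n) ^ p * ENNReal.ofReal (D ^ 3 * K) * ENNReal.ofReal D +
    (34 ^ n) ^ p with hc
  have hct : c ≠ ⊤ := by
    have h4 : ((4 : ℝ≥0∞) ^ n) ^ p ≠ ⊤ := ENNReal.rpow_ne_top_of_nonneg hp.le (by finiteness)
    have h34 : ((34 : ℝ≥0∞) ^ n) ^ p ≠ ⊤ := ENNReal.rpow_ne_top_of_nonneg hp.le (by finiteness)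
    finiteness
  have hc0 : c ≠ 0 := by
    have : ((34 : ℝ≥0∞) ^ n) ^ p ≠ 0 :=
      (ENNReal.rpow_pos (by positivity) (by finiteness)).ne'
    simp [hc, this]
  have hcS0 : c * shellSum K θ ≠ 0 := mul_ne_zero hc0 (shellSum_ne_zero hK)
  have hcSt : c * shellSum K θ ≠ ⊤ := ENNReal.mul_ne_top hct (shellSum_ne_top hθ)
  have hC0 : (c * shellSum K θ) ^ p⁻¹ ≠ 0 :=
    (ENNReal.rpow_pos (pos_iff_ne_zero.2 hcS0) hcSt).ne'
  have hCt : (c * shellSum K θ) ^ p⁻¹ ≠ ⊤ :=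
    ENNReal.rpow_ne_top_of_nonneg (inv_nonneg.2 hp.le) hcSt
  refine ⟨((c * shellSum K θ) ^ p⁻¹).toNNReal, ENNReal.toNNReal_pos hC0 hCt,
    fun φ hG w hA f hf hfN => ?_⟩
  rw [ENNReal.coe_toNNReal hCt]
  refine weakLocalMorreyNorm_le hp fun R hR t ht => ?_
  set N := localMorreyNorm φ w p (absFun f)
  set A := localMorreyAConst φ w p
  set E := {x | ENNReal.ofReal t < hlMaximal f x}
  -- The shells miss the origin, which is null because n ≥ 1.
  have hW0 : weightMeasure w ({0} : Set (RSpace n)) = 0 := by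
    have : Nonempty (Fin n) := ⟨⟨0, hn⟩⟩
    exact withDensity_absolutelyContinuous _ _ (measure_singleton _)
  have hshell : ∀ ρ, 0 < ρ → (ENNReal.ofReal t ^ p • (weightMeasure w).restrict E) (shell n ρ) ≤
      c * (A * N) ^ p * ENNReal.ofReal (φ 0 ρ) := by
    intro ρ hρ
    rw [Measure.smul_apply, smul_eq_mul, Measure.restrict_apply (measurableSet_shell ρ)]
    have hlarge : ENNReal.ofReal t ^ p * weightMeasure w
        {x | x ∈ shell n ρ ∧ ENNReal.ofReal t < largeBallMaximal f ρ} ≤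
        (34 ^ n) ^ p * (A * N) ^ p * ENNReal.ofReal (φ 0 ρ) := by
      by_cases hL : ENNReal.ofReal t < largeBallMaximal f ρ
      · calc _ ≤ largeBallMaximal f ρ ^ p * weightMeasure w (ball 0 ρ) := by
              gcongr
              exact fun x hx => mem_ball_zero_iff.2 hx.1.2
          _ ≤ _ := largeBallMaximal_rpow_mul_le hG hp hA hρ hf hfN.ne
          _ = _ := by rw [mul_assoc (34 ^ n), ENNReal.mul_rpow_of_nonneg _ (A * N) hp.le]
      · simp [hL]
    have hsmall := weak_centeredMaximal_shell hNb hG hθ.le hp hA hρ hf hfN.ne t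
    refine (mul_le_mul_right ((measure_mono (t := _ ∪ _) ?_).trans (measure_union_le _ _)) _).trans
      ((mul_add _ _ _).trans_le ((add_le_add hsmall hlarge).trans (le_of_eq ?_)))
    · rintro x ⟨hx, hxE⟩
      have := lt_of_lt_of_le hxE (hlMaximal_le_max_of_mem_shell hρ f hx)
      rcases lt_max_iff.1 this with h | h
      · exact Or.inl ⟨hx, h⟩
      · exact Or.inr ⟨hx, h⟩
    · rw [hc]; ring
  have hsum := measure_ball_le_of_shell hG _ (by
    rw [Measure.smul_apply, smul_eq_mul,
      Measure.absolutelyContinuous_of_le Measure.restrict_le_self hW0, mul_zero]) hshell hR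
  rw [Measure.smul_apply, smul_eq_mul, Measure.restrict_apply isOpen_ball.measurableSet] at hsum
  refine hsum.trans (le_of_eq ?_)
  rw [mul_assoc _ A N, ENNReal.mul_rpow_of_nonneg _ (A * N) hp.le, ENNReal.rpow_inv_rpow hp.ne']
  ring

end Weak

/-! ### The dual weight and the strong type estimate -/

section Strong

variable {n : ℕ} {φ : RSpace n → ℝ → ℝ} {w : RSpace n → ℝ} {p D K θ : ℝ}

instance (w : RSpace n → ℝ) : SFinite (weightMeasure w) := by
  unfold weightMeasure; infer_instance

/-- The dual weight `w ^ (-1 / (p - 1))`. -/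
noncomputable def dualWeight (w : RSpace n → ℝ) (p : ℝ) (x : RSpace n) : ℝ≥0∞ :=
  ENNReal.ofReal (w x) ^ (-(p - 1)⁻¹)

theorem IsWeight.aemeasurable_dualWeight (hw : IsWeight w) (p : ℝ) :
    AEMeasurable (dualWeight w p) :=
  hw.aemeasurable_ofReal.pow_const _

/-- Valid also where w vanishes: both sides are then ∞. -/
theorem dualWeight_rpow (hp : 1 < p) (x : RSpace n) :
    dualWeight w p x ^ (p - 1) = (ENNReal.ofReal (w x))⁻¹ := by
  have : p - 1 ≠ 0 := by linarith
  rw [dualWeight, ← ENNReal.rpow_mul, neg_mul, inv_mul_cancel₀ this, ENNReal.rpow_neg_one]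

/-- On small balls centered on a shell, the weight satisfies the classical Muckenhoupt
condition. -/
theorem lintegral_dualWeight_rpow_mul_le (hG : CenteredGrowth φ D K θ) (hθ : 0 ≤ θ)
    (hp : 1 < p) (hw : IsWeight w) (hA : localMorreyAConst φ w p ≠ ⊤) {ρ : ℝ} (hρ : 0 < ρ)
    {c : RSpace n} {s : ℝ} (hs : 0 < s) (hsub : ball c s ⊆ ball 0 (2 * ρ))
    (hdisj : ∀ x ∈ ball c s, ρ / 4 ≤ ‖x‖) :
    (∫⁻ x in ball c s, dualWeight w p x) ^ (p - 1) * weightMeasure w (ball c s) ≤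
      localMorreyAConst φ w p ^ p * ENNReal.ofReal (D ^ 3 * K) * volume (ball c s) ^ p := by
  have hp0 : 0 < p := by linarith
  have hp1 : 0 < p - 1 := by linarith
  set Q := localMorreyAConst φ w p ^ p * ENNReal.ofReal (D ^ 3 * K)
  set V := volume (ball c s)
  have hW := hw.weightMeasure_ball_ne_top c s
  set Wb := weightMeasure w (ball c s)
  rcases eq_or_ne Wb 0 with hW0 | hW0
  · simp [hW0]
  -- Testing with σ itself would give X^p w(B) ≤ Q X |B|^p for X = ∫_B σ, because σ^p w ≤ σ.
  -- Truncating at height k makes X finite, so that one factor X can be cancelled; then k → ∞.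
  set h : ℕ → RSpace n → ℝ≥0∞ := fun k x => min (dualWeight w p x) k
  have hm : ∀ k, AEMeasurable (h k) := fun k =>
    (hw.aemeasurable_dualWeight p).min aemeasurable_const
  have hk : ∀ k : ℕ, ∫⁻ x in ball c s, h k x ≤ (Q * V ^ p / Wb) ^ (p - 1)⁻¹ := by
    intro k
    set X := ∫⁻ x in ball c s, h k x
    have e : absFun (fun x => (h k x).toReal) = h k := by
      ext x
      have : h k x ≠ ⊤ := ne_top_of_le_ne_top (ENNReal.natCast_ne_top k) (min_le_right _ _)
      simp [absFun, Real.enorm_eq_ofReal ENNReal.toReal_nonneg, ENNReal.ofReal_toReal this]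
    have hX : X ≠ ⊤ := by
      refine ne_top_of_le_ne_top (b := k * V)
        (ENNReal.mul_ne_top (ENNReal.natCast_ne_top k) (volume_ball_ne_top c s)) ?_
      rw [← setLIntegral_const]
      exact lintegral_mono fun x => min_le_right _ _
    have hle : ∫⁻ x in ball c s, h k x ^ p * ENNReal.ofReal (w x) ≤ X := by
      refine lintegral_mono fun x => ?_
      have h1 : h k x ^ p = h k x * h k x ^ (p - 1) := by
        conv_lhs => rw [show p = 1 + (p - 1) by ring,
          ENNReal.rpow_add_of_nonneg _ _ zero_le_one hp1.le, ENNReal.rpow_one]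
      have h2 : h k x ^ (p - 1) ≤ (ENNReal.ofReal (w x))⁻¹ := by
        rw [← dualWeight_rpow hp]
        exact ENNReal.rpow_le_rpow (min_le_left _ _) hp1.le
      calc _ = h k x * (h k x ^ (p - 1) * ENNReal.ofReal (w x)) := by rw [h1, mul_assoc]
        _ ≤ h k x * ((ENNReal.ofReal (w x))⁻¹ * ENNReal.ofReal (w x)) := by gcongr
        _ ≤ h k x * 1 := by gcongr; exact ENNReal.inv_mul_le_one _
        _ = h k x := mul_one _
    have hkey := setLIntegral_rpow_mul_weightMeasure_le hG hθ hp0 hA hρ hs hsub hdisj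
      (f := fun x => (h k x).toReal) (hm k).ennreal_toReal
      (by rw [e]; exact ne_top_of_le_ne_top hX hle)
    rw [e] at hkey
    rw [ENNReal.le_rpow_inv_iff hp1, ENNReal.le_div_iff_mul_le (Or.inl hW0) (Or.inl hW)]
    rcases eq_or_ne X 0 with hX0 | hX0
    · simp [hX0, hp1]
    rw [← ENNReal.mul_le_mul_iff_right hX0 hX]
    calc X * (X ^ (p - 1) * Wb) = X ^ p * Wb := by
          conv_rhs => rw [show p = 1 + (p - 1) by ring,
            ENNReal.rpow_add_of_nonneg _ _ zero_le_one hp1.le, ENNReal.rpow_one]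
          ring
      _ ≤ _ := hkey
      _ ≤ Q * X * V ^ p := by gcongr
      _ = _ := by ring
  have hsup : ∫⁻ x in ball c s, dualWeight w p x = ⨆ k, ∫⁻ x in ball c s, h k x := by
    rw [← lintegral_iSup' (fun k => (hm k).restrict) (Filter.Eventually.of_forall fun x i j hij =>
      min_le_min le_rfl (by exact_mod_cast hij))]
    refine lintegral_congr fun x => ?_
    simp only [h]
    rw [← inf_iSup_eq, ENNReal.iSup_natCast]
    simp
  rw [← ENNReal.le_div_iff_mul_le (Or.inl hW0) (Or.inl hW), ← ENNReal.le_rpow_inv_iff hp1, hsup]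
  exact iSup_le hk

/-- If the Muckenhoupt-type constant is finite, a weight either vanishes almost everywhere or is
positive almost everywhere. -/
theorem weightMeasure_eq_zero_or_ae_pos (hp : 0 < p)
    (hw : IsWeight w) (hA : localMorreyAConst φ w p ≠ ⊤) :
    weightMeasure w = 0 ∨ ∀ᵐ x, 0 < w x := by
  by_cases h : ∃ k : ℕ, weightMeasure w (ball 0 k) ≠ 0
  · right
    obtain ⟨k, hk⟩ := h
    have hk0 : 0 < (k : ℝ) := by
      by_contra hk'
      rw [ball_eq_empty.2 (not_lt.1 hk')] at hk
      simp at hk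
    -- The indicator of {w = 0} has norm 0, so by duality its integral vanishes on every ball whose
    -- characteristic function has nonzero norm.
    set f : RSpace n → ℝ := fun x => ({0} : Set ℝ).indicator (fun _ => 1) (w x)
    have hf : AEMeasurable f volume :=
      (measurable_const.indicator (measurableSet_singleton _)).comp_aemeasurable
        hw.2.aestronglyMeasurable.aemeasurable
    have hfN : localMorreyNorm φ w p (absFun f) ≤ 0 := by
      refine localMorreyNorm_le hp fun R hR => ?_
      have : ∀ x, absFun f x ^ p * ENNReal.ofReal (w x) = 0 := by
        intro x
        by_cases hx : w x = 0 <;> simp [absFun, f, hx, hp]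
      simp [this]
    have hfN0 : localMorreyNorm φ w p (absFun f) = 0 := le_antisymm hfN zero_le
    have hball : ∀ m : ℕ, ∫⁻ x in ball 0 (k + m : ℝ), absFun f x = 0 := by
      intro m
      have hkey := setLIntegral_mul_localMorreyNorm_charFn_le hp hA hf (by simp [hfN0]) 0
        (r := k + m) (by positivity)
      rw [hfN0, mul_zero, zero_mul, nonpos_iff_eq_zero, mul_eq_zero] at hkey
      refine hkey.resolve_right fun h0 => ?_
      have h1 := rpow_le_localMorreyNorm (φ := φ) (w := w) (p := p)
        (g := charFn (ball 0 (k + m : ℝ))) hk0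
      rw [h0, setLIntegral_charFn_rpow hp, Set.inter_eq_right.2
        (ball_subset_ball (by simp)), nonpos_iff_eq_zero, ENNReal.rpow_eq_zero_iff_of_pos
        (by positivity), ENNReal.div_eq_zero_iff] at h1
      exact h1.elim hk ENNReal.ofReal_ne_top
    have hae : ∀ m : ℕ, ∀ᵐ x, x ∈ ball (0 : RSpace n) (k + m : ℝ) → absFun f x = 0 := by
      intro m
      rw [← ae_restrict_iff' isOpen_ball.measurableSet]
      exact (lintegral_eq_zero_iff' (hf.enorm.restrict)).1 (hball m)
    filter_upwards [ae_all_iff.2 hae] with x hx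
    obtain ⟨m, hm⟩ := exists_nat_gt ‖x‖
    have := hx m (mem_ball_zero_iff.2 (by linarith))
    refine lt_of_le_of_ne (hw.1 x) fun h0 => ?_
    simp [absFun, f, ← h0] at this
  · left
    push Not at h
    rw [← Measure.measure_univ_eq_zero, ← iUnion_ball_nat (0 : RSpace n)]
    exact measure_iUnion_null h

/-- Two-step domination of a centered maximal function by weighted ones. -/
theorem centeredMaximal_rpow_le (hp : 1 < p) (hw : IsWeight w) (hpos : ∀ᵐ x, 0 < w x)
    {Q : ℝ≥0∞} (hQ : Q ≠ ⊤) {a : ℝ} (ha : 0 < a) {x : RSpace n}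
    (hT : ∀ r, 0 < r → r ≤ 4 * a → (∫⁻ y in ball x r, dualWeight w p y) ^ (p - 1) *
      weightMeasure w (ball x r) ≤ Q * volume (ball x r) ^ p)
    {g : RSpace n → ℝ≥0∞} (hg : AEMeasurable g volume) :
    centeredMaximal volume a g x ^ (p - 1) ≤ Q * (4 ^ n) ^ p *
      centeredMaximal (weightMeasure w) a (fun y =>
        centeredMaximal (volume.withDensity (dualWeight w p)) (2 * a)
          (fun z => g z / dualWeight w p z) y ^ (p - 1) * (ENNReal.ofReal (w y))⁻¹) x := by
  have hp0 : 0 < p := by linarith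
  have hp1 : 0 < p - 1 := by linarith
  set σ := dualWeight w p with hσ
  have hσm : AEMeasurable σ volume := hw.aemeasurable_dualWeight p
  have hσpos : ∀ᵐ y, σ y ≠ 0 ∧ σ y ≠ ⊤ := by
    filter_upwards [hpos] with y hy
    have hy0 : ENNReal.ofReal (w y) ≠ 0 := by simpa using hy
    exact ⟨(ENNReal.rpow_pos (pos_iff_ne_zero.2 hy0) ENNReal.ofReal_ne_top).ne',
      ENNReal.rpow_ne_top_of_ne_zero hy0 ENNReal.ofReal_ne_top⟩
  set μ := volume.withDensity σ
  set M := centeredMaximal μ (2 * a) (fun z => g z / σ z)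
  have hgσ : AEMeasurable (fun z => g z / σ z) volume := hg.div hσm
  have hMm : Measurable M :=
    measurable_centeredMaximal μ _ (hgσ.mono_ac (withDensity_absolutelyContinuous _ _))
  have hGm : AEMeasurable (fun y => M y ^ (p - 1) * (ENNReal.ofReal (w y))⁻¹) volume :=
    (hMm.pow_const _).aemeasurable.mul hw.aemeasurable_ofReal.inv
  rw [← ENNReal.le_rpow_inv_iff hp1]
  refine iSup_le fun m => ?_
  rw [ENNReal.le_rpow_inv_iff hp1]
  refine le_trans ?_ (mul_le_mul_right (le_iSup _ m) _)
  have hra : a / 2 ^ m ≤ a := div_le_self ha.le (one_le_pow₀ (by norm_num))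
  have h2r : 2 * a / 2 ^ m = 2 * (a / 2 ^ m) := by ring
  have hr0 : 0 < a / 2 ^ m := by positivity
  have hMr : ∀ y, (∫⁻ z in closedBall y (2 * (a / 2 ^ m)), g z / σ z ∂μ) /
      μ (closedBall y (2 * (a / 2 ^ m))) ≤ M y := by
    intro y
    rw [← h2r]
    exact le_iSup (fun m : ℕ => (∫⁻ z in closedBall y (2 * a / 2 ^ m), g z / σ z ∂μ) /
      μ (closedBall y (2 * a / 2 ^ m))) m
  set r := a / 2 ^ m
  set B := closedBall x r
  have hBm : MeasurableSet B := isClosed_closedBall.measurableSet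
  set B4 := ball x (4 * r)
  have hBB4 : B ⊆ B4 := closedBall_subset_ball (by linarith)
  set V := volume B with hV
  have hV0 : V ≠ 0 := (measure_closedBall_pos volume x hr0).ne'
  have hVt : V ≠ ⊤ := measure_closedBall_lt_top.ne
  have hV4 : volume B4 = 4 ^ n * V := by
    rw [hV, ← measure_congr (ball_ae_eq_closedBall x hr0), volume_ball_mul x x (by norm_num)]
    norm_num
  have hWpos : ∀ s : Set (RSpace n), volume s ≠ 0 → weightMeasure w s ≠ 0 := by
    intro s hs h0
    apply hs
    refine (withDensity_absolutelyContinuous' hw.aemeasurable_ofReal ?_) h0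
    filter_upwards [hpos] with y hy
    simpa using hy
  have hW0 : weightMeasure w B ≠ 0 := hWpos B hV0
  have hW4 : weightMeasure w B4 ≠ 0 := hWpos B4 (volume_ball_ne_zero x (by positivity))
  have hWt : weightMeasure w B ≠ ⊤ :=
    ne_top_of_le_ne_top (hw.weightMeasure_ball_ne_top x (4 * r)) (measure_mono hBB4)
  have hT4 := hT (4 * r) (by positivity) (by linarith)
  have hμ4 : μ B4 = ∫⁻ y in B4, σ y := withDensity_apply' _ _
  rw [← hμ4] at hT4
  have hμt : μ B4 ≠ ⊤ := by
    intro h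
    change μ B4 ^ (p - 1) * weightMeasure w B4 ≤ Q * volume B4 ^ p at hT4
    rw [h, ENNReal.top_rpow_of_pos hp1, ENNReal.top_mul hW4, top_le_iff] at hT4
    exact ENNReal.mul_ne_top hQ (ENNReal.rpow_ne_top_of_nonneg hp0.le (volume_ball_ne_top _ _)) hT4
  set X := ∫⁻ y in B, g y
  -- For every y in B = B(x,r), one has B ⊆ B(y,2r) ⊆ B(x,4r). Hence ∫_B g is at most σ(B(x,4r))
  -- times the centered σ-maximal function at y; this is why the inner operator runs over the radii
  -- 2a/2^m and the hypothesis reaches 4a.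
  have hpt : ∀ y ∈ B, X ≤ μ B4 * M y := by
    intro y hy
    rw [mem_closedBall] at hy
    set B2 := closedBall y (2 * r)
    have hB2m : MeasurableSet B2 := isClosed_closedBall.measurableSet
    have hBB2 : B ⊆ B2 := by
      intro z hz
      rw [mem_closedBall] at hz ⊢
      linarith [dist_triangle_right z y x]
    have hB2B4 : B2 ⊆ B4 := by
      intro z hz
      rw [mem_closedBall] at hz
      rw [mem_ball]
      linarith [dist_triangle z y x]
    have hμ2t : μ B2 ≠ ⊤ := ne_top_of_le_ne_top hμt (measure_mono hB2B4)
    have hμ20 : μ B2 ≠ 0 := by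
      intro h0
      have := withDensity_absolutelyContinuous' hσm (hσpos.mono fun _ h => h.1) h0
      exact (measure_closedBall_pos volume y (by positivity)).ne' this
    have hint : ∫⁻ z in B2, g z / σ z ∂μ = ∫⁻ z in B2, g z := by
      rw [restrict_withDensity hB2m, lintegral_withDensity_eq_lintegral_mul₀ hσm.restrict
        hgσ.restrict]
      refine lintegral_congr_ae (ae_restrict_of_ae ?_)
      filter_upwards [hσpos] with z hz
      exact ENNReal.mul_div_cancel hz.1 hz.2
    calc X ≤ ∫⁻ z in B2, g z := lintegral_mono_set hBB2
      _ = μ B2 * ((∫⁻ z in B2, g z / σ z ∂μ) / μ B2) := by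
          rw [hint, ENNReal.mul_div_cancel hμ20 hμ2t]
      _ ≤ μ B4 * M y := mul_le_mul' (measure_mono hB2B4) (hMr y)
  have hint2 : ∫⁻ y in B, M y ^ (p - 1) * (ENNReal.ofReal (w y))⁻¹ ∂(weightMeasure w) =
      ∫⁻ y in B, M y ^ (p - 1) := by
    rw [weightMeasure, restrict_withDensity hBm, lintegral_withDensity_eq_lintegral_mul₀
      hw.aemeasurable_ofReal.restrict hGm.restrict]
    refine lintegral_congr_ae (ae_restrict_of_ae ?_)
    filter_upwards [hpos] with z hz
    rw [Pi.mul_apply, mul_left_comm, ENNReal.mul_inv_cancel (by simpa using hz)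
      ENNReal.ofReal_ne_top, mul_one]
  rw [hint2]
  set J := ∫⁻ y in B, M y ^ (p - 1) with hJ
  -- Raise the pointwise bound to the power p - 1, integrate over y in B, and absorb
  -- σ(B(x,4r))^(p-1) w(B) by the A_p condition on B(x,4r).
  have hmain : X ^ (p - 1) * weightMeasure w B * V ≤ Q * (4 ^ n * V) ^ p * J := by
    rw [hJ, ← lintegral_const_mul _ (hMm.pow_const _), ← setLIntegral_const]
    refine setLIntegral_mono' hBm fun y hy => ?_
    calc X ^ (p - 1) * weightMeasure w B ≤ (μ B4 * M y) ^ (p - 1) * weightMeasure w B4 :=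
          mul_le_mul' (ENNReal.rpow_le_rpow (hpt y hy) hp1.le) (measure_mono hBB4)
      _ = μ B4 ^ (p - 1) * weightMeasure w B4 * M y ^ (p - 1) := by
          rw [ENNReal.mul_rpow_of_nonneg _ _ hp1.le]; ring
      _ ≤ _ := by
          rw [← hV4]
          exact mul_le_mul_left hT4 _
  have hVp : V ^ p = V ^ (p - 1) * V := by
    conv_lhs => rw [show p = (p - 1) + 1 by ring,
      ENNReal.rpow_add_of_nonneg _ _ hp1.le zero_le_one, ENNReal.rpow_one]
  rw [ENNReal.mul_rpow_of_nonneg _ _ hp0.le, hVp] at hmain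
  have hmain2 : X ^ (p - 1) * weightMeasure w B ≤ Q * (4 ^ n) ^ p * J * V ^ (p - 1) := by
    rw [← ENNReal.mul_le_mul_iff_left hV0 hVt]
    exact hmain.trans (le_of_eq (by ring))
  have hVp0 : V ^ (p - 1) ≠ 0 := (ENNReal.rpow_pos (pos_iff_ne_zero.2 hV0) hVt).ne'
  have hVpt : V ^ (p - 1) ≠ ⊤ := ENNReal.rpow_ne_top_of_nonneg hp1.le hVt
  rw [ENNReal.div_rpow_of_nonneg _ _ hp1.le, ENNReal.div_le_iff hVp0 hVpt, ← mul_div_assoc,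
    ENNReal.mul_comm_div, ← mul_div_assoc, ENNReal.le_div_iff_mul_le (Or.inl hW0) (Or.inl hWt)]
  exact hmain2

/-- The weighted strong type estimate on a set for the centered maximal function. -/
theorem exists_lintegral_centeredMaximal_rpow_le_of_muckenhoupt (hp : 1 < p) (hw : IsWeight w)
    (hpos : ∀ᵐ x, 0 < w x) {Q : ℝ≥0∞} (hQ : Q ≠ ⊤) : ∃ C : ℝ≥0, ∀ (S : Set (RSpace n)) (a : ℝ),
      MeasurableSet S → 0 < a →
      (∀ x ∈ S, ∀ r, 0 < r → r ≤ 4 * a → (∫⁻ y in ball x r, dualWeight w p y) ^ (p - 1) *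
        weightMeasure w (ball x r) ≤ Q * volume (ball x r) ^ p) →
      ∀ g : RSpace n → ℝ≥0∞, AEMeasurable g volume →
      ∫⁻ x in S, centeredMaximal volume a g x ^ p ∂(weightMeasure w) ≤
        C * ∫⁻ x, g x ^ p * ENNReal.ofReal (w x) := by
  have hp0 : 0 < p := by linarith
  have hp1 : 0 < p - 1 := by linarith
  -- The conjugate exponent: (p - 1)q = p converts the bound on the power p - 1 into one on the
  -- power p, and w^(1-q) = σ converts the outer L^q(w) norm into the inner L^p(σ) norm.
  set q := p / (p - 1) with hq
  have hq1 : 1 < q := by rw [hq, one_lt_div hp1]; linarith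
  have hq0 : 0 < q := by linarith
  have hpq : (p - 1) * q = p := by rw [hq]; field_simp
  obtain ⟨C₁, hC₁⟩ := exists_lintegral_centeredMaximal_rpow_le n hq1
  obtain ⟨C₂, hC₂⟩ := exists_lintegral_centeredMaximal_rpow_le n hp
  set k : ℝ≥0∞ := (Q * (4 ^ n) ^ p) ^ q
  have hk : k ≠ ⊤ := by
    have h4 : ((4 : ℝ≥0∞) ^ n) ^ p ≠ ⊤ := ENNReal.rpow_ne_top_of_nonneg hp0.le (by finiteness)
    exact ENNReal.rpow_ne_top_of_nonneg hq0.le (ENNReal.mul_ne_top hQ h4)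
  refine ⟨k.toNNReal * C₁ * C₂, fun S a hS ha hT g hg => ?_⟩
  push_cast
  rw [ENNReal.coe_toNNReal hk]
  set σ := dualWeight w p with hσ
  have hσm : AEMeasurable σ volume := hw.aemeasurable_dualWeight p
  set μ := volume.withDensity σ
  set M := centeredMaximal μ (2 * a) (fun z => g z / σ z)
  have hgσ' : AEMeasurable (fun z => g z / σ z) volume := hg.div hσm
  have hgσ : AEMeasurable (fun z => g z / σ z) μ :=
    hgσ'.mono_ac (withDensity_absolutelyContinuous _ _)
  have hMm : Measurable M := measurable_centeredMaximal μ _ hgσ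
  have hGm : AEMeasurable (fun y => M y ^ (p - 1) * (ENNReal.ofReal (w y))⁻¹) volume :=
    (hMm.pow_const _).aemeasurable.mul hw.aemeasurable_ofReal.inv
  calc ∫⁻ x in S, centeredMaximal volume a g x ^ p ∂(weightMeasure w)
      ≤ ∫⁻ x in S, k * centeredMaximal (weightMeasure w) a
          (fun y => M y ^ (p - 1) * (ENNReal.ofReal (w y))⁻¹) x ^ q ∂(weightMeasure w) := by
        refine setLIntegral_mono' hS fun x hx => ?_
        have h := ENNReal.rpow_le_rpow
          (centeredMaximal_rpow_le hp hw hpos hQ ha (hT x hx) hg) hq0.le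
        rw [← ENNReal.rpow_mul, hpq, ENNReal.mul_rpow_of_nonneg _ _ hq0.le] at h
        exact h
    _ = k * ∫⁻ x in S, centeredMaximal (weightMeasure w) a
          (fun y => M y ^ (p - 1) * (ENNReal.ofReal (w y))⁻¹) x ^ q ∂(weightMeasure w) :=
        lintegral_const_mul' _ _ hk
    _ ≤ k * (C₁ * ∫⁻ y, (M y ^ (p - 1) * (ENNReal.ofReal (w y))⁻¹) ^ q ∂(weightMeasure w)) := by
        refine mul_le_mul_right ((setLIntegral_le_lintegral _ _).trans ?_) _
        exact hC₁ _ a ha _ (hGm.mono_ac (withDensity_absolutelyContinuous _ _))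
    _ = k * (C₁ * ∫⁻ y, M y ^ p ∂μ) := by
        congr 2
        rw [weightMeasure, lintegral_withDensity_eq_lintegral_mul₀ hw.aemeasurable_ofReal
          (hGm.pow_const _), lintegral_withDensity_eq_lintegral_mul₀ hσm
          (hMm.pow_const _).aemeasurable]
        refine lintegral_congr_ae ?_
        filter_upwards [hpos] with y hy
        have hy0 : ENNReal.ofReal (w y) ≠ 0 := by simpa using hy
        rw [Pi.mul_apply, Pi.mul_apply, ENNReal.mul_rpow_of_nonneg _ _ hq0.le,
          ← ENNReal.rpow_mul, hpq, mul_left_comm, mul_comm (σ y)]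
        congr 1
        rw [hσ, dualWeight, ENNReal.inv_rpow, ← ENNReal.rpow_neg]
        conv_lhs => rw [← ENNReal.rpow_one (ENNReal.ofReal (w y)), ← ENNReal.rpow_mul, one_mul,
          ← ENNReal.rpow_add _ _ hy0 ENNReal.ofReal_ne_top]
        congr 1
        rw [hq]
        field_simp
        ring
    _ ≤ k * (C₁ * (C₂ * ∫⁻ y, (g y / σ y) ^ p ∂μ)) := by
        gcongr
        exact hC₂ μ _ (by positivity) _ hgσ
    -- Since σ^(1-p) = w almost everywhere, (g/σ)^p σ = g^p w.
    _ = k * C₁ * C₂ * ∫⁻ x, g x ^ p * ENNReal.ofReal (w x) := by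
        rw [lintegral_withDensity_eq_lintegral_mul₀ hσm (hgσ'.pow_const _), mul_assoc,
          mul_assoc]
        congr 3
        refine lintegral_congr_ae ?_
        filter_upwards [hpos] with y hy
        have hy0 : ENNReal.ofReal (w y) ≠ 0 := by simpa using hy
        have hσ0 : σ y ≠ 0 := (ENNReal.rpow_pos (pos_iff_ne_zero.2 hy0) ENNReal.ofReal_ne_top).ne'
        have hσt : σ y ≠ ⊤ := ENNReal.rpow_ne_top_of_ne_zero hy0 ENNReal.ofReal_ne_top
        have h1 : σ y ^ (p - 1) * ENNReal.ofReal (w y) = 1 := by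
          rw [hσ, dualWeight_rpow hp, ENNReal.inv_mul_cancel hy0 ENNReal.ofReal_ne_top]
        have h2 : σ y ^ p = σ y ^ (p - 1) * σ y := by
          conv_lhs => rw [show p = (p - 1) + 1 by ring,
            ENNReal.rpow_add_of_nonneg _ _ hp1.le zero_le_one, ENNReal.rpow_one]
        have h3 : σ y ^ p ≠ 0 := (ENNReal.rpow_pos (pos_iff_ne_zero.2 hσ0) hσt).ne'
        have h4 : σ y ^ p ≠ ⊤ := ENNReal.rpow_ne_top_of_nonneg hp0.le hσt
        rw [Pi.mul_apply, ENNReal.div_rpow_of_nonneg _ _ hp0.le]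
        calc σ y * (g y ^ p / σ y ^ p)
            = σ y * (g y ^ p / σ y ^ p) * (σ y ^ (p - 1) * ENNReal.ofReal (w y)) := by
              rw [h1, mul_one]
          _ = σ y ^ p * (g y ^ p / σ y ^ p) * ENNReal.ofReal (w y) := by rw [h2]; ring
          _ = _ := by rw [ENNReal.mul_div_cancel h3 h4]

/-- The strong type estimate. -/
theorem isBoundedOperator_hlMaximal (hn : 1 ≤ n) (hG : CenteredGrowth φ D K θ) (hθ : 0 < θ)
    (hp : 1 < p) (hw : IsWeight w) (hA : localMorreyAConst φ w p ≠ ⊤) :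
    IsBoundedOperator hlMaximal (localMorreyNorm φ w p) (localMorreyNorm φ w p) := by
  have hp0 : 0 < p := by linarith
  have hD := hG.one_le_D
  -- The two-step domination divides by w and σ, so it needs w > 0 almost everywhere. If w is null,
  -- the norm of Mf is 0.
  rcases weightMeasure_eq_zero_or_ae_pos hp0 hw hA with hW | hpos
  · refine ⟨0, fun f _ _ => ?_⟩
    have hwz : (fun x => ENNReal.ofReal (w x)) =ᵐ[volume] 0 := by
      rwa [weightMeasure, withDensity_eq_zero_iff hw.aemeasurable_ofReal] at hW
    rw [ENNReal.coe_zero, zero_mul]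
    refine localMorreyNorm_le hp0 fun R hR => ?_
    rw [lintegral_congr_ae (g := fun _ => 0)]
    · simp
    · refine ae_restrict_of_ae ?_
      filter_upwards [hwz] with x hx
      simp [hx]
  set A := localMorreyAConst φ w p
  set Q := A ^ p * ENNReal.ofReal (D ^ 3 * K)
  have hQ : Q ≠ ⊤ := ENNReal.mul_ne_top (ENNReal.rpow_ne_top_of_nonneg hp0.le hA)
    ENNReal.ofReal_ne_top
  obtain ⟨C, hC⟩ := exists_lintegral_centeredMaximal_rpow_le_of_muckenhoupt hp hw hpos hQ
  set c : ℝ≥0∞ := (4 ^ n) ^ p * C * ENNReal.ofReal D + (34 ^ n * A) ^ p with hc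
  have hct : c ≠ ⊤ := by
    have h4 : ((4 : ℝ≥0∞) ^ n) ^ p ≠ ⊤ := ENNReal.rpow_ne_top_of_nonneg hp0.le (by finiteness)
    have h34 : ((34 : ℝ≥0∞) ^ n * A) ^ p ≠ ⊤ :=
      ENNReal.rpow_ne_top_of_nonneg hp0.le (by finiteness)
    finiteness
  have hcSt : c * shellSum K θ ≠ ⊤ := ENNReal.mul_ne_top hct (shellSum_ne_top hθ)
  have hCt : (c * shellSum K θ) ^ p⁻¹ ≠ ⊤ :=
    ENNReal.rpow_ne_top_of_nonneg (inv_nonneg.2 hp0.le) hcSt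
  refine ⟨((c * shellSum K θ) ^ p⁻¹).toNNReal, fun f hf hfN => ?_⟩
  rw [ENNReal.coe_toNNReal hCt]
  refine localMorreyNorm_le hp0 fun R hR => ?_
  set N := localMorreyNorm φ w p (absFun f)
  set ν := volume.withDensity fun x => hlMaximal f x ^ p * ENNReal.ofReal (w x)
  have hν0 : ν ({0} : Set (RSpace n)) = 0 := by
    have : Nonempty (Fin n) := ⟨⟨0, hn⟩⟩
    exact withDensity_absolutelyContinuous _ _ (measure_singleton _)
  have hν : ∀ s, MeasurableSet s → ν s = ∫⁻ x in s, hlMaximal f x ^ p ∂(weightMeasure w) := by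
    intro s hs
    rw [withDensity_apply _ hs, weightMeasure, restrict_withDensity hs,
      lintegral_withDensity_eq_lintegral_mul₀ hw.aemeasurable_ofReal.restrict
        ((measurable_hlMaximal f).pow_const _).aemeasurable]
    simp only [Pi.mul_apply, mul_comm]
  have hshell : ∀ ρ, 0 < ρ → ν (shell n ρ) ≤ c * N ^ p * ENNReal.ofReal (φ 0 ρ) := by
    intro ρ hρ
    rw [hν _ (measurableSet_shell ρ)]
    set g := (ball 0 (2 * ρ)).indicator (absFun f)
    have hgm : AEMeasurable g volume := hf.enorm.indicator isOpen_ball.measurableSet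
    have hgint : ∫⁻ x, g x ^ p * ENNReal.ofReal (w x) ≤
        N ^ p * (ENNReal.ofReal D * ENNReal.ofReal (φ 0 ρ)) := by
      have e : ∀ x, g x ^ p * ENNReal.ofReal (w x) = (ball 0 (2 * ρ)).indicator
          (fun x => absFun f x ^ p * ENNReal.ofReal (w x)) x := by
        intro x
        by_cases hx : x ∈ ball 0 (2 * ρ) <;> simp only [g, hx, Set.indicator_of_mem,
          Set.indicator_of_notMem, not_false_eq_true, ENNReal.zero_rpow_of_pos hp0, zero_mul]
      simp_rw [e]
      rw [lintegral_indicator isOpen_ball.measurableSet]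
      refine (setLIntegral_le_localMorreyNorm_rpow hp0 (by positivity)
        (hG.pos _ (by positivity))).trans ?_
      gcongr
      rw [← ENNReal.ofReal_mul (by positivity)]
      exact ENNReal.ofReal_le_ofReal (hG.doubling ρ hρ)
    -- With a = ρ/16 the radii required are at most 4a = ρ/4, exactly the range in which balls
    -- centered on the shell stay outside B(0,ρ/4).
    have hsmall := hC (shell n ρ) (ρ / 16) (measurableSet_shell ρ) (by positivity)
      (fun x hx r hr hra => by
        obtain ⟨h1, h2⟩ := ball_subset_of_mem_shell hx (s := r) (by linarith)
        exact lintegral_dualWeight_rpow_mul_le hG hθ.le hp hw hA hρ hr h1 h2) g hgm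
    calc ∫⁻ x in shell n ρ, hlMaximal f x ^ p ∂(weightMeasure w)
        ≤ ∫⁻ x in shell n ρ, (4 ^ n) ^ p * centeredMaximal volume (ρ / 16) g x ^ p +
            largeBallMaximal f ρ ^ p ∂(weightMeasure w) := by
          refine setLIntegral_mono' (measurableSet_shell ρ) fun x hx => ?_
          refine (ENNReal.rpow_le_rpow (hlMaximal_le_max_of_mem_shell hρ f hx) hp0.le).trans ?_
          rw [(ENNReal.monotone_rpow_of_nonneg hp0.le).map_max,
            ENNReal.mul_rpow_of_nonneg _ _ hp0.le]
          exact max_le_add_of_nonneg zero_le zero_le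
      _ = (4 ^ n) ^ p * ∫⁻ x in shell n ρ, centeredMaximal volume (ρ / 16) g x ^ p
            ∂(weightMeasure w) + largeBallMaximal f ρ ^ p * weightMeasure w (shell n ρ) := by
          rw [lintegral_add_right _ measurable_const, setLIntegral_const, lintegral_const_mul' _ _
            (ENNReal.rpow_ne_top_of_nonneg hp0.le (by finiteness))]
      _ ≤ (4 ^ n) ^ p * (C * (N ^ p * (ENNReal.ofReal D * ENNReal.ofReal (φ 0 ρ)))) +
            (34 ^ n * A * N) ^ p * ENNReal.ofReal (φ 0 ρ) := by
          refine add_le_add ?_ ?_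
          · gcongr
            exact hsmall.trans (by gcongr)
          · refine le_trans ?_ (largeBallMaximal_rpow_mul_le hG hp0 hA hρ hf hfN.ne)
            gcongr
            exact fun x hx => mem_ball_zero_iff.2 hx.2
      _ = _ := by
          rw [hc, ENNReal.mul_rpow_of_nonneg _ N hp0.le]
          ring
  have hsum := measure_ball_le_of_shell hG ν hν0 hshell hR
  rw [withDensity_apply _ isOpen_ball.measurableSet] at hsum
  refine hsum.trans (le_of_eq ?_)
  rw [ENNReal.mul_rpow_of_nonneg _ N hp0.le, ENNReal.rpow_inv_rpow hp0.ne']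
  ring

end Strong

/-! ### Passage from balls to centered radii, and conclusion -/

/-- Concentric balls have volume ratio (r/R)^n, whence the exponent nδ. Enlarging D and K to at
least 1 keeps both inequalities because φ is positive. -/
theorem CenteredGrowth.of_onBalls {n : ℕ} {φ : RSpace n → ℝ → ℝ} {D K δ : ℝ}
    (hφ : PositiveOnBalls φ) (hD : DoublingOnBalls φ D) (hK : ReverseDoublingOnBalls φ K δ) :
    CenteredGrowth φ (max D 1) (max K 1) (n * δ) where
  one_le_D := le_max_right _ _
  one_le_K := le_max_right _ _
  pos R hR := hφ 0 R hR
  doubling R hR := (hD 0 R hR).trans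
    (mul_le_mul_of_nonneg_right (le_max_left _ _) (hφ 0 R hR).le)
  reverse r R hr hrR := by
    have hR : 0 < R := hr.trans_le hrR
    have h := hK 0 r 0 R hr hR (ball_subset_ball hrR)
    have hv : ∀ s : ℝ, 0 < s → volume.real (ball (0 : RSpace n) s) =
        s ^ n * volume.real (ball (0 : RSpace n) 1) := by
      intro s hs
      have := volume_ball_mul (0 : RSpace n) 0 hs 1
      rw [mul_one] at this
      rw [measureReal_def, this, ENNReal.toReal_mul, ENNReal.toReal_ofReal (by positivity),
        measureReal_def]
    have h1 : volume.real (ball (0 : RSpace n) 1) ≠ 0 :=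
      (ENNReal.toReal_pos (volume_ball_ne_zero 0 one_pos) (volume_ball_ne_top 0 1)).ne'
    rw [hv r hr, hv R hR, mul_div_mul_right _ _ h1, ← div_pow, ← Real.rpow_natCast,
      ← Real.rpow_mul (by positivity), div_le_iff₀ (hφ 0 R hR)] at h
    refine h.trans ?_
    have := (hφ 0 R hR).le
    gcongr
    exact le_max_left _ _

theorem mainTheorem1 (n : ℕ) (hn : 1 ≤ n) (p : ℝ) (hp : 1 ≤ p) (D K δ : ℝ) (hδ : 0 < δ) :
    ∃ c₁ c₂ : ℝ≥0, 0 < c₁ ∧ 0 < c₂ ∧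
      ∀ φ : RSpace n → ℝ → ℝ, PositiveOnBalls φ → DoublingOnBalls φ D →
        ReverseDoublingOnBalls φ K δ →
        ∀ w : RSpace n → ℝ, IsWeight w →
          (1 < p →
            (IsBoundedOperator hlMaximal (localMorreyNorm φ w p) (localMorreyNorm φ w p) ↔
              MemLocalMorreyA φ w p)) ∧
          (IsBoundedOperator hlMaximal (localMorreyNorm φ w p) (weakLocalMorreyNorm φ w p) ↔
            MemLocalMorreyA φ w p) ∧
          c₁ * localMorreyAConst φ w p ≤
            operatorNorm hlMaximal (localMorreyNorm φ w p) (weakLocalMorreyNorm φ w p) ∧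
          operatorNorm hlMaximal (localMorreyNorm φ w p) (weakLocalMorreyNorm φ w p) ≤
            c₂ * localMorreyAConst φ w p := by
  have hp0 : 0 < p := by linarith
  have hθ : 0 < n * δ := mul_pos (by exact_mod_cast hn) hδ
  obtain ⟨C, hC0, hC⟩ := exists_weakLocalMorreyNorm_hlMaximal_le (D := max D 1) hn hp0
    (le_max_right K 1) hθ
  refine ⟨1, C, one_pos, hC0, fun φ hφ hD hK w hw => ?_⟩
  have hG := CenteredGrowth.of_onBalls hφ hD hK
  have hweak : IsBoundedOperator hlMaximal (localMorreyNorm φ w p) (weakLocalMorreyNorm φ w p) →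
      MemLocalMorreyA φ w p := fun ⟨B, hB⟩ =>
    (localMorreyAConst_le_of_isOperatorBound hp0 hB).trans_lt ENNReal.coe_lt_top
  refine ⟨fun hp1 => ⟨fun ⟨B, hB⟩ => hweak ⟨B, fun f hf hfN => ?_⟩, fun hA => ?_⟩,
    ⟨hweak, fun hA => ?_⟩, ?_, ?_⟩
  · exact (weakLocalMorreyNorm_le_localMorreyNorm hp0 hG.pos (measurable_hlMaximal f)).trans
      (hB f hf hfN)
  · exact isBoundedOperator_hlMaximal hn hG hθ hp1 hw hA.ne
  · refine ⟨C * (localMorreyAConst φ w p).toNNReal, ?_⟩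
    rw [ENNReal.coe_mul, ENNReal.coe_toNNReal hA.ne]
    exact hC φ hG w hA.ne
  · rw [ENNReal.coe_one, one_mul]
    exact le_sInf fun B hB => localMorreyAConst_le_of_isOperatorBound hp0 hB
  -- For an infinite constant the upper bound is trivial only because c₂ > 0, as 0 · ∞ = 0.
  · rcases eq_or_ne (localMorreyAConst φ w p) ⊤ with hA | hA
    · rw [hA, ENNReal.mul_top (by exact_mod_cast hC0.ne')]
      exact le_top
    · exact sInf_le (hC φ hG w hA)
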